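/- Let $\Bbbk$ be a field of characteristic zero, $\ell\ge 1$ and $\mathbf u=(u_1,\dots,u_\ell)\in\Bbbk^\ell$. **The affine web category.** Let $\mathcal{AW}$ be the strict $\Bbbk$-linear monoidal category with generating objects $a\in\mathbb Z_{\ge1}$ (so its objects are the finite sequences of positive integers, with concatenation as $\otimes$) and generating morphisms, for $a,b\ge1$: merges $m_{a,b}:(a,b)\to(a+b)$, splits $s_{a,b}:(a+b)\to(a,b)$, crossings $x_{a,b}:(a,b)\to(b,a)$ and dotted strands $\omega_a:(a)\to(a)$. Strands of thickness $0$ are omitted (so $m_{a,0},m_{0,a},s_{a,0},s_{0,a},x_{a,0},x_{0,a},\omega_0$ are identities). For $s+p=a$, $q+t=c$, $s+q=b$, $p+t=d$ and $y:(p,q)\to(q,p)$ put $L_{s,p,q,t}(y)=(m_{s,q}\otimes m_{p,t})\circ(1_s\otimes y\otimes 1_t)\circ(s_{s,p}\otimes s_{q,t}):(a,c)\to(b,d)$. The defining relations are, for all $a,b,c,d\ge1$ (with $a+c=b+d$ in the third): 1. $m_{a+b,c}(m_{a,b}\otimes1_c)=m_{a,b+c}(1_a\otimes m_{b,c})$ and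 $(s_{a,b}\otimes 1_c)s_{a+b,c}=(1_a\otimes s_{b,c})s_{a,b+c}$; 2. $s_{a,b}$ followed by $m_{a,b}$ equals $\binom{a+b}{a}1_{a+b}$; 3. $s_{b,d}\,m_{a,c}=\sum L_{s,a-s,c-t,t}(x_{a-s,c-t})$, summed over $0\le s\le\min(a,b)$, $0\le t\le\min(c,d)$ with $t-s=d-a$; 4. $(\omega_b\otimes1_a)x_{a,b}=\sum_{t=0}^{\min(a,b)}t!\,L_{t,a-t,b-t,t}\big(x_{a-t,b-t}(1_{a-t}\otimes\omega_{b-t})\big)$ and $x_{b,a}(\omega_b\otimes1_a)=\sum_{t=0}^{\min(a,b)}t!\,L_{t,b-t,a-t,t}\big((1_{a-t}\otimes\omega_{b-t})x_{b-t,a-t}\big)$; 5. $s_{a,b}\,\omega_{a+b}=(\omega_a\otimes\omega_b)s_{a,b}$ and $\omega_{a+b}\,m_{a,b}=m_{a,b}(\omega_a\otimes\omega_b)$; 6. $B_a(\omega_1)=a!\,\omega_a$, where, for an endomorphism $f$ of the object $(1)$, the *balloon* $B_a(f)\in\mathrm{End}(a)$ is the composite of the $a$-fold split $(a)\to(1,\dots,1)$,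 the morphism $f^{\otimes a}$, and the $a$-fold merge $(1,\dots,1)\to(a)$. For $0\le i\le r$ let $\omega_{i}^{(r)}=m_{i,r-i}(\omega_i\otimes1_{r-i})s_{i,r-i}\in\mathrm{End}(r)$, and for $r\ge1$, $u\in\Bbbk$ let $$g_{r,u}=\sum_{i=0}^{r}(-1)^i\,u(u+1)\cdots(u+i-1)\;\omega_{r-i}^{(r)}\in\mathrm{End}_{\mathcal{AW}}(r),$$ so that $g_{1,u}=\omega_1-u\cdot 1_1$. A *right tensor ideal* of $\mathcal{AW}$ is a family of subspaces of the morphism spaces that is closed under composition with arbitrary morphisms on both sides and under $f\mapsto f\otimes 1_\lambda$ for all objects $\lambda$. Let $I_{\mathbf u}$ be the right tensor ideal generated by $\prod_{j=1}^\ell g_{r,u_j}$ for all $r\ge1$, and $I'_{\mathbf u}$ the one generated by the single morphism $\prod_{j=1}^\ell g_{1,u_j}=\prod_{j=1}^\ell(\omega_1-u_j)$. Let $\mathrm{Web}_{\mathbf u}=\mathcal{AW}/I_{\mathbf u}$ (the cyclotomic web category) and $\mathrm{Web}'_{\mathbf u}=\mathcal{AW}/I'_{\mathbf u}$. **Theorem.**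 $I'_{\mathbf u}=I_{\mathbf u}$. Consequently there is an isomorphism of $\Bbbk$-linear categories $\mathrm{Web}'_{\mathbf u}\cong\mathrm{Web}_{\mathbf u}$ that is compatible with the quotient functors from $\mathcal{AW}$. Moreover, for every $r\ge1$, $$r!\,\prod_{j=1}^\ell g_{r,u_j}=B_r\Big(\prod_{j=1}^\ell g_{1,u_j}\Big)\quad\text{in }\mathrm{End}_{\mathcal{AW}}(r).$$ -/

import Mathlib

open CategoryTheory MonoidalCategory

-- so that `X ⟶ Y` is always elaborated through the category structure
attribute [-instance] catToReflQuiver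

/-! ## Strict `k`-linear monoidal categories given by generators and relations

The objects are the words in the set `S` of generating objects, with concatenation as tensor product
and the empty word as unit object. -/

namespace StrictPresentation

universe v

section Terms

variable {S : Type} (k : Type v) (G : List S → List S → Type)

/-- Formal `k`-linear combinations of formal composites (`comp f g` is "first `f`, then `g`") and
formal tensor products of the generating morphisms in `G` and identities. -/
inductive Term : List S → List S → Type v
  | gen {X Y : List S} (g : G X Y) : Term X Y
  | id (X : List S) : Term X X
  | comp {X Y Z : List S} (f : Term X Y) (g : Term Y Z) : Term X Z
  | tensor {X Y X' Y' : List S} (f : Term X Y) (g : Term X' Y') : Term (X ++ X') (Y ++ Y')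
  | zero (X Y : List S) : Term X Y
  | add {X Y : List S} (f g : Term X Y) : Term X Y
  | smul {X Y : List S} (c : k) (f : Term X Y) : Term X Y

variable {k G}

/-- Transport of a term along equalities of its source and target words. -/
def Term.cast {X Y X' Y' : List S} (hX : X = X') (hY : Y = Y') (f : Term k G X Y) :
    Term k G X' Y' :=
  hX ▸ hY ▸ f

variable [CommRing k]

/-- The smallest congruence on terms which contains `R` and for which the axioms of a strict
`k`-linear monoidal category hold. -/
inductive Term.Rel (R : ∀ X Y : List S, Term k G X Y → Term k G X Y → Prop) :
    ∀ {X Y : List S}, Term k G X Y → Term k G X Y → Prop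
  | of {X Y} {f g : Term k G X Y} : R X Y f g → Rel R f g
  -- equivalence relation
  | refl {X Y} (f : Term k G X Y) : Rel R f f
  | symm {X Y} {f g : Term k G X Y} : Rel R f g → Rel R g f
  | trans {X Y} {f g h : Term k G X Y} : Rel R f g → Rel R g h → Rel R f h
  -- compatibility with the operations
  | comp_congr {X Y Z} {f f' : Term k G X Y} {g g' : Term k G Y Z} :
      Rel R f f' → Rel R g g' → Rel R (f.comp g) (f'.comp g')
  | tensor_congr {X Y X' Y'} {f f' : Term k G X Y} {g g' : Term k G X' Y'} :
      Rel R f f' → Rel R g g' → Rel R (f.tensor g) (f'.tensor g')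
  | add_congr {X Y} {f f' g g' : Term k G X Y} :
      Rel R f f' → Rel R g g' → Rel R (f.add g) (f'.add g')
  | smul_congr {X Y} (c : k) {f f' : Term k G X Y} :
      Rel R f f' → Rel R (f.smul c) (f'.smul c)
  -- category axioms
  | id_comp {X Y} (f : Term k G X Y) : Rel R ((Term.id X).comp f) f
  | comp_id {X Y} (f : Term k G X Y) : Rel R (f.comp (Term.id Y)) f
  | comp_assoc {W X Y Z} (f : Term k G W X) (g : Term k G X Y) (h : Term k G Y Z) :
      Rel R ((f.comp g).comp h) (f.comp (g.comp h))
  -- the morphism sets are `k`-modules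
  | add_assoc {X Y} (f g h : Term k G X Y) : Rel R ((f.add g).add h) (f.add (g.add h))
  | add_comm {X Y} (f g : Term k G X Y) : Rel R (f.add g) (g.add f)
  | zero_add {X Y} (f : Term k G X Y) : Rel R ((Term.zero X Y).add f) f
  | one_smul {X Y} (f : Term k G X Y) : Rel R (f.smul 1) f
  | zero_smul {X Y} (f : Term k G X Y) : Rel R (f.smul 0) (Term.zero X Y)
  | mul_smul {X Y} (c d : k) (f : Term k G X Y) : Rel R (f.smul (c * d)) ((f.smul d).smul c)
  | smul_add {X Y} (c : k) (f g : Term k G X Y) :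
      Rel R ((f.add g).smul c) ((f.smul c).add (g.smul c))
  | add_smul {X Y} (c d : k) (f : Term k G X Y) :
      Rel R (f.smul (c + d)) ((f.smul c).add (f.smul d))
  -- composition and tensor product are `k`-bilinear
  | add_comp {X Y Z} (f f' : Term k G X Y) (g : Term k G Y Z) :
      Rel R ((f.add f').comp g) ((f.comp g).add (f'.comp g))
  | comp_add {X Y Z} (f : Term k G X Y) (g g' : Term k G Y Z) :
      Rel R (f.comp (g.add g')) ((f.comp g).add (f.comp g'))
  | smul_comp {X Y Z} (c : k) (f : Term k G X Y) (g : Term k G Y Z) :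
      Rel R ((f.smul c).comp g) ((f.comp g).smul c)
  | comp_smul {X Y Z} (c : k) (f : Term k G X Y) (g : Term k G Y Z) :
      Rel R (f.comp (g.smul c)) ((f.comp g).smul c)
  | add_tensor {X Y X' Y'} (f f' : Term k G X Y) (g : Term k G X' Y') :
      Rel R ((f.add f').tensor g) ((f.tensor g).add (f'.tensor g))
  | tensor_add {X Y X' Y'} (f : Term k G X Y) (g g' : Term k G X' Y') :
      Rel R (f.tensor (g.add g')) ((f.tensor g).add (f.tensor g'))
  | smul_tensor {X Y X' Y'} (c : k) (f : Term k G X Y) (g : Term k G X' Y') :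
      Rel R ((f.smul c).tensor g) ((f.tensor g).smul c)
  | tensor_smul {X Y X' Y'} (c : k) (f : Term k G X Y) (g : Term k G X' Y') :
      Rel R (f.tensor (g.smul c)) ((f.tensor g).smul c)
  -- the tensor product is a strictly associative and strictly unital bifunctor
  | id_tensor_id (X Y : List S) : Rel R ((Term.id X).tensor (Term.id Y)) (Term.id (X ++ Y))
  | tensor_comp {X Y Z X' Y' Z'} (f : Term k G X Y) (g : Term k G Y Z)
      (f' : Term k G X' Y') (g' : Term k G Y' Z') :
      Rel R ((f.comp g).tensor (f'.comp g')) ((f.tensor f').comp (g.tensor g'))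
  | tensor_assoc {X Y X' Y' X'' Y''} (f : Term k G X Y) (f' : Term k G X' Y')
      (f'' : Term k G X'' Y'') :
      Rel R (Term.cast (List.append_assoc X X' X'') (List.append_assoc Y Y' Y'')
        ((f.tensor f').tensor f'')) (f.tensor (f'.tensor f''))
  | unit_tensor {X Y} (f : Term k G X Y) : Rel R ((Term.id []).tensor f) f
  | tensor_unit {X Y} (f : Term k G X Y) :
      Rel R (Term.cast (List.append_nil X) (List.append_nil Y) (f.tensor (Term.id []))) f

end Terms

variable {S : Type} {k : Type v} [CommRing k] {G : List S → List S → Type}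

/-- The strict `k`-linear monoidal category with generating objects `S`, generating morphisms `G`
and defining relations `R`; its objects are the words in `S`. -/
structure Presented (R : ∀ X Y : List S, Term k G X Y → Term k G X Y → Prop) : Type where
  /-- The underlying word. -/
  word : List S

namespace Presented

variable {R : ∀ X Y : List S, Term k G X Y → Term k G X Y → Prop}

/-- Morphisms: terms modulo the congruence generated by `R`. -/
protected def Hom (X Y : Presented R) : Type v :=
  Quot (Term.Rel R (X := X.word) (Y := Y.word))

instance : Category.{v} (Presented R) where
  Hom := Presented.Hom
  id X := Quot.mk _ (Term.id X.word)
  comp f g := Quot.map₂ Term.comp (fun f _ _ h => .comp_congr (.refl f) h)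
    (fun _ _ g h => .comp_congr h (.refl g)) f g
  id_comp := by rintro _ _ ⟨f⟩; exact Quot.sound (.id_comp f)
  comp_id := by rintro _ _ ⟨f⟩; exact Quot.sound (.comp_id f)
  assoc := by rintro _ _ _ _ ⟨f⟩ ⟨g⟩ ⟨h⟩; exact Quot.sound (.comp_assoc f g h)

/-- The morphism represented by a term. -/
def homMk (R : ∀ X Y : List S, Term k G X Y → Term k G X Y → Prop) {X Y : List S}
    (f : Term k G X Y) : (⟨X⟩ : Presented R) ⟶ ⟨Y⟩ :=
  Quot.mk _ f

theorem sound {X Y : List S} {f g : Term k G X Y} (h : Term.Rel R f g) : homMk R f = homMk R g :=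
  Quot.sound h

instance : Preadditive (Presented R) where
  homGroup X Y :=
    let iA : Add (X ⟶ Y) :=
      ⟨fun f g => Quot.map₂ Term.add (fun f _ _ h => .add_congr (.refl f) h)
        (fun _ _ g h => .add_congr h (.refl g)) f g⟩
    let iZ : Zero (X ⟶ Y) := ⟨Quot.mk _ (Term.zero _ _)⟩
    let iN : Neg (X ⟶ Y) :=
      ⟨fun f => Quot.map (Term.smul (-1)) (fun _ _ h => .smul_congr _ h) f⟩
    { add_assoc := by rintro ⟨f⟩ ⟨g⟩ ⟨h⟩; exact Quot.sound (.add_assoc f g h)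
      zero_add := by rintro ⟨f⟩; exact Quot.sound (.zero_add f)
      add_zero := by
        rintro ⟨f⟩; exact Quot.sound (.trans (.add_comm f _) (.zero_add f))
      add_comm := by rintro ⟨f⟩ ⟨g⟩; exact Quot.sound (.add_comm f g)
      neg_add_cancel := by
        rintro ⟨f⟩
        refine Quot.sound (.trans (.add_congr (.refl _) (.symm (.one_smul f))) ?_)
        refine .trans (.symm (.add_smul (-1) 1 f)) ?_
        rw [neg_add_cancel]
        exact .zero_smul f
      nsmul := nsmulRec
      zsmul := zsmulRec }
  add_comp := by rintro _ _ _ ⟨f⟩ ⟨f'⟩ ⟨g⟩; exact Quot.sound (.add_comp f f' g)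
  comp_add := by rintro _ _ _ ⟨f⟩ ⟨g⟩ ⟨g'⟩; exact Quot.sound (.comp_add f g g')

instance : Linear k (Presented R) where
  homModule X Y :=
    let iS : SMul k (X ⟶ Y) :=
      ⟨fun c f => Quot.map (Term.smul c) (fun _ _ h => .smul_congr c h) f⟩
    { one_smul := by rintro ⟨f⟩; exact Quot.sound (.one_smul f)
      mul_smul := by rintro c d ⟨f⟩; exact Quot.sound (.mul_smul c d f)
      smul_add := by rintro c ⟨f⟩ ⟨g⟩; exact Quot.sound (.smul_add c f g)
      add_smul := by rintro c d ⟨f⟩; exact Quot.sound (.add_smul c d f)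
      zero_smul := by rintro ⟨f⟩; exact Quot.sound (.zero_smul f)
      smul_zero := by
        intro c
        refine Quot.sound (.trans (.smul_congr c (.symm (.zero_smul (Term.zero _ _)))) ?_)
        refine .trans (.symm (.mul_smul c 0 _)) ?_
        rw [mul_zero]
        exact .zero_smul _ }
  smul_comp := by rintro _ _ _ c ⟨f⟩ ⟨g⟩; exact Quot.sound (.smul_comp c f g)
  comp_smul := by rintro _ _ _ ⟨f⟩ c ⟨g⟩; exact Quot.sound (.comp_smul c f g)

theorem homMk_cast {X Y X' Y' : List S} (hX : X = X') (hY : Y = Y') (f : Term k G X Y) :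
    homMk R (f.cast hX hY) =
      eqToHom (by rw [hX]) ≫ homMk R f ≫ eqToHom (by rw [hY]) := by
  subst hX hY
  simp [Term.cast]

/-- The tensor product is concatenation of words and the tensor product of terms; the associators
and unitors are the identity morphisms (`eqToIso` of the equality of source and target). -/
instance : MonoidalCategoryStruct (Presented R) where
  tensorObj X Y := ⟨X.word ++ Y.word⟩
  tensorUnit := ⟨[]⟩
  tensorHom f g := Quot.map₂ Term.tensor (fun f _ _ h => .tensor_congr (.refl f) h)
    (fun _ _ g h => .tensor_congr h (.refl g)) f g
  whiskerLeft X _ _ g := Quot.map (fun g => (Term.id X.word).tensor g)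
    (fun _ _ h => .tensor_congr (.refl _) h) g
  whiskerRight f Y := Quot.map (fun f => f.tensor (Term.id Y.word))
    (fun _ _ h => .tensor_congr h (.refl _)) f
  associator X Y Z := eqToIso (congrArg Presented.mk (List.append_assoc X.word Y.word Z.word))
  leftUnitor X := eqToIso (congrArg Presented.mk (List.nil_append X.word))
  rightUnitor X := eqToIso (congrArg Presented.mk (List.append_nil X.word))

theorem associator_hom (X Y Z : Presented R) : (α_ X Y Z).hom =
    eqToHom (congrArg Presented.mk (List.append_assoc X.word Y.word Z.word)) := rfl

theorem leftUnitor_hom (X : Presented R) : (λ_ X).hom =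
    eqToHom (congrArg Presented.mk (List.nil_append X.word)) := rfl

theorem rightUnitor_hom (X : Presented R) : (ρ_ X).hom =
    eqToHom (congrArg Presented.mk (List.append_nil X.word)) := rfl

theorem eqToHom_tensor_id {X Y : Presented R} (h : X = Y) (Z : Presented R) :
    eqToHom h ⊗ₘ 𝟙 Z = eqToHom (congrArg (· ⊗ Z) h) := by
  subst h
  exact Quot.sound (.id_tensor_id _ _)

theorem id_tensor_eqToHom (Z : Presented R) {X Y : Presented R} (h : X = Y) :
    𝟙 Z ⊗ₘ eqToHom h = eqToHom (congrArg (Z ⊗ ·) h) := by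
  subst h
  exact Quot.sound (.id_tensor_id _ _)

instance : MonoidalCategory (Presented R) :=
  MonoidalCategory.ofTensorHom
    (id_tensorHom_id := fun _ _ => Quot.sound (.id_tensor_id _ _))
    (id_tensorHom := by rintro _ _ _ ⟨g⟩; rfl)
    (tensorHom_id := by rintro _ _ ⟨f⟩ _; rfl)
    (tensorHom_comp_tensorHom := by
      rintro _ _ _ _ _ _ ⟨f⟩ ⟨f'⟩ ⟨g⟩ ⟨g'⟩
      exact Quot.sound (.symm (.tensor_comp f g f' g')))
    (associator_naturality := by
      rintro _ _ _ _ _ _ ⟨f⟩ ⟨f'⟩ ⟨f''⟩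
      have h := sound (Term.Rel.tensor_assoc (R := R) f f' f'')
      rw [homMk_cast, eqToHom_comp_iff, comp_eqToHom_iff, Category.assoc, ← Category.assoc] at h
      rw [associator_hom, associator_hom, comp_eqToHom_iff]
      exact h)
    (leftUnitor_naturality := by
      rintro _ _ ⟨f⟩
      have h := sound (Term.Rel.unit_tensor (R := R) f)
      change homMk R _ ≫ 𝟙 _ = 𝟙 _ ≫ homMk R _
      rw [Category.comp_id, Category.id_comp]
      exact h)
    (rightUnitor_naturality := by
      rintro _ _ ⟨f⟩
      have h := sound (Term.Rel.tensor_unit (R := R) f)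
      rw [homMk_cast, eqToHom_comp_iff] at h
      exact h)
    (pentagon := fun W X Y Z => by
      rw [associator_hom, associator_hom, associator_hom, associator_hom, associator_hom,
        eqToHom_tensor_id, id_tensor_eqToHom]
      simp)
    (triangle := fun X Y => by
      rw [associator_hom, leftUnitor_hom, rightUnitor_hom, eqToHom_tensor_id, id_tensor_eqToHom]
      simp)

instance : MonoidalPreadditive (Presented R) where
  whiskerLeft_zero := by
    rintro X Y Z
    refine Quot.sound (.trans (.tensor_congr (.refl _) (.symm (.zero_smul (Term.zero _ _)))) ?_)
    exact .trans (.tensor_smul _ _ _) (.zero_smul _)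
  zero_whiskerRight := by
    rintro X Y Z
    refine Quot.sound (.trans (.tensor_congr (.symm (.zero_smul (Term.zero _ _))) (.refl _)) ?_)
    exact .trans (.smul_tensor _ _ _) (.zero_smul _)
  whiskerLeft_add := by rintro _ _ _ ⟨f⟩ ⟨g⟩; exact Quot.sound (.tensor_add _ f g)
  add_whiskerRight := by rintro _ _ _ ⟨f⟩ ⟨g⟩; exact Quot.sound (.add_tensor f g _)

instance : MonoidalLinear k (Presented R) where
  whiskerLeft_smul := by rintro _ _ _ c ⟨f⟩; exact Quot.sound (.tensor_smul c _ f)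
  smul_whiskerRight := by rintro c _ _ ⟨f⟩ _; exact Quot.sound (.smul_tensor c f _)

end Presented
end StrictPresentation

/-! ## Right tensor ideals -/

universe w v u

/-- A right tensor ideal of a `k`-linear monoidal category: submodules of all the morphism modules,
closed under composition with arbitrary morphisms on both sides and under `f ↦ f ⊗ 1_Z`
(hence under `f ↦ f ⊗ g` for every morphism `g`). -/
@[ext]
structure RightTensorIdeal (k : Type w) (C : Type u) [CommRing k] [Category.{v} C]
    [Preadditive C] [Linear k C] [MonoidalCategory C] where
  /-- The morphisms `X ⟶ Y` which belong to the ideal. -/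
  carrier (X Y : C) : Submodule k (X ⟶ Y)
  precomp_mem {X Y Z : C} (f : X ⟶ Y) {g : Y ⟶ Z} : g ∈ carrier Y Z → f ≫ g ∈ carrier X Z
  postcomp_mem {X Y Z : C} {f : X ⟶ Y} (g : Y ⟶ Z) : f ∈ carrier X Y → f ≫ g ∈ carrier X Z
  whiskerRight_mem {X Y : C} {f : X ⟶ Y} (Z : C) :
    f ∈ carrier X Y → f ▷ Z ∈ carrier (X ⊗ Z) (Y ⊗ Z)

namespace RightTensorIdeal

variable (k : Type w) {C : Type u} [CommRing k] [Category.{v} C] [Preadditive C] [Linear k C]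
  [MonoidalCategory C]

/-- Membership in the right tensor ideal generated by the class `P` of morphisms. -/
inductive SpanMem (P : MorphismProperty C) : ∀ {X Y : C}, (X ⟶ Y) → Prop
  | of {X Y : C} {f : X ⟶ Y} : P f → SpanMem P f
  | zero (X Y : C) : SpanMem P (0 : X ⟶ Y)
  | add {X Y : C} {f g : X ⟶ Y} : SpanMem P f → SpanMem P g → SpanMem P (f + g)
  | smul {X Y : C} (c : k) {f : X ⟶ Y} : SpanMem P f → SpanMem P (c • f)
  | precomp {X Y Z : C} (f : X ⟶ Y) {g : Y ⟶ Z} : SpanMem P g → SpanMem P (f ≫ g)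
  | postcomp {X Y Z : C} {f : X ⟶ Y} (g : Y ⟶ Z) : SpanMem P f → SpanMem P (f ≫ g)
  | whiskerRight {X Y : C} {f : X ⟶ Y} (Z : C) : SpanMem P f → SpanMem P (f ▷ Z)

/-- The right tensor ideal generated by a class of morphisms. -/
def span (P : MorphismProperty C) : RightTensorIdeal k C where
  carrier X Y :=
    { carrier := {f | SpanMem k P f}
      add_mem' := .add
      zero_mem' := .zero X Y
      smul_mem' := fun c _ h => .smul c h }
  precomp_mem f _ h := .precomp f h
  postcomp_mem g h := .postcomp g h
  whiskerRight_mem Z h := .whiskerRight Z h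

variable {k}

/-- Congruence modulo a right tensor ideal. -/
def homRel (I : RightTensorIdeal k C) : HomRel C := fun X Y f g => f - g ∈ I.carrier X Y

instance (I : RightTensorIdeal k C) : Congruence I.homRel where
  equivalence :=
    { refl := fun f => by simp [homRel]
      symm := fun {f g} h => by
        have h' := Submodule.neg_mem _ h
        rwa [neg_sub] at h'
      trans := fun {f g h} h₁ h₂ => by
        have h' := Submodule.add_mem _ h₁ h₂
        rwa [sub_add_sub_cancel] at h' }
  comp_left f g g' h := by
    have h' := I.precomp_mem f h
    rwa [Preadditive.comp_sub] at h'
  comp_right g h := by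
    have h' := I.postcomp_mem g h
    rwa [Preadditive.sub_comp] at h'

theorem homRel_add (I : RightTensorIdeal k C) ⦃X Y : C⦄ (f₁ f₂ g₁ g₂ : X ⟶ Y)
    (hf : I.homRel f₁ f₂) (hg : I.homRel g₁ g₂) : I.homRel (f₁ + g₁) (f₂ + g₂) := by
  have h := Submodule.add_mem _ hf hg
  rwa [sub_add_sub_comm] at h

theorem homRel_smul (I : RightTensorIdeal k C) (c : k) ⦃X Y : C⦄ (f₁ f₂ : X ⟶ Y)
    (hf : I.homRel f₁ f₂) : I.homRel (c • f₁) (c • f₂) := by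
  have h := Submodule.smul_mem _ c hf
  rwa [smul_sub] at h

/-- The quotient of a `k`-linear monoidal category by a right tensor ideal. It is a `k`-linear
category with the same objects. -/
abbrev Quotient (I : RightTensorIdeal k C) := CategoryTheory.Quotient I.homRel

/-- The quotient functor. -/
abbrev quotientFunctor (I : RightTensorIdeal k C) : C ⥤ I.Quotient :=
  CategoryTheory.Quotient.functor I.homRel

instance (I : RightTensorIdeal k C) : Preadditive I.Quotient :=
  CategoryTheory.Quotient.preadditive I.homRel I.homRel_add

instance (I : RightTensorIdeal k C) : I.quotientFunctor.Additive :=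
  CategoryTheory.Quotient.functor_additive I.homRel I.homRel_add

instance (I : RightTensorIdeal k C) : Linear k I.Quotient :=
  CategoryTheory.Quotient.linear k I.homRel I.homRel_smul

end RightTensorIdeal

/-! ## The affine web category -/

namespace AffineWeb

open StrictPresentation Finset

/-- The generating morphisms of the affine web category: merges, splits, crossings, and the dotted
strands `ω_a`. The generating objects are the thicknesses `a ≥ 1`. -/
inductive Gen : List ℕ+ → List ℕ+ → Type
  | merge (a b : ℕ+) : Gen [a, b] [a + b]
  | split (a b : ℕ+) : Gen [a + b] [a, b]
  | cross (a b : ℕ+) : Gen [a, b] [b, a]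
  | dot (a : ℕ+) : Gen [a] [a]

section Diagrams

variable {k : Type v} [CommRing k] (R : ∀ X Y : List ℕ+, Term k Gen X Y → Term k Gen X Y → Prop)

/-- The word of a single strand of thickness `a`, empty if `a = 0`. -/
def strandWord : ℕ → List ℕ+
  | 0 => []
  | a + 1 => [a.succPNat]

/-- A single strand of thickness `a`; a strand of thickness `0` is the unit object. -/
def strand (a : ℕ) : Presented R := ⟨strandWord a⟩

/-- The merge of strands of thickness `a` and `b`, an identity morphism if `a` or `b` is zero. -/
def mergeAux : ∀ a b : ℕ, strand R a ⊗ strand R b ⟶ strand R (a + b)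
  | 0, b => eqToHom (by rw [Nat.zero_add]; rfl)
  | _ + 1, 0 => eqToHom rfl
  | a + 1, b + 1 => Presented.homMk R (.gen (.merge a.succPNat b.succPNat))

/-- The split into strands of thickness `a` and `b`, an identity morphism if `a` or `b` is zero. -/
def splitAux : ∀ a b : ℕ, strand R (a + b) ⟶ strand R a ⊗ strand R b
  | 0, b => eqToHom (by rw [Nat.zero_add]; rfl)
  | _ + 1, 0 => eqToHom rfl
  | a + 1, b + 1 => Presented.homMk R (.gen (.split a.succPNat b.succPNat))

/-- The merge of strands of thickness `a` and `b` into one of thickness `c = a + b`. -/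
def merge (a b c : ℕ) (h : a + b = c := by omega) : strand R a ⊗ strand R b ⟶ strand R c :=
  mergeAux R a b ≫ eqToHom (congrArg (strand R) h)

/-- The split of a strand of thickness `c = a + b` into strands of thickness `a` and `b`. -/
def split (a b c : ℕ) (h : a + b = c := by omega) : strand R c ⟶ strand R a ⊗ strand R b :=
  eqToHom (congrArg (strand R) h.symm) ≫ splitAux R a b

/-- The crossing of strands of thickness `a` and `b`, an identity morphism if `a` or `b` is zero. -/
def cross : ∀ a b : ℕ, strand R a ⊗ strand R b ⟶ strand R b ⊗ strand R a
  | 0, 0 => eqToHom rfl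
  | 0, _ + 1 => eqToHom rfl
  | _ + 1, 0 => eqToHom rfl
  | a + 1, b + 1 => Presented.homMk R (.gen (.cross a.succPNat b.succPNat))

/-- The strand of thickness `a` with the dot `ω_a`, an identity morphism if `a` is zero. -/
def dot : ∀ a : ℕ, strand R a ⟶ strand R a
  | 0 => 𝟙 _
  | a + 1 => Presented.homMk R (.gen (.dot a.succPNat))

/-- The diagram `(a, c) ⟶ (b, d)` in which (from bottom to top) the strand `a` splits into `(s, p)`,
the strand `c` splits into `(q, t)`, the morphism `x` (a crossing, possibly with a dot) is
applied to the middle strands `(p, q)`, and then `(s, q)` merge into `b` and `(p, t)` into `d`. -/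
def ladder {a b c d : ℕ} (s p q t : ℕ)
    (x : strand R p ⊗ strand R q ⟶ strand R q ⊗ strand R p)
    (ha : s + p = a := by omega) (hc : q + t = c := by omega)
    (hb : s + q = b := by omega) (hd : p + t = d := by omega) :
    strand R a ⊗ strand R c ⟶ strand R b ⊗ strand R d :=
  (split R s p a ha ⊗ₘ split R q t c hc) ⊗≫ strand R s ◁ x ▷ strand R t ⊗≫
    (merge R s q b hb ⊗ₘ merge R p t d hd)

/-- The word `(1, …, 1)` with `r` letters. -/
def thinWord : ℕ → List ℕ+
  | 0 => []
  | r + 1 => strandWord 1 ++ thinWord r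

/-- The object `(1, …, 1)` given by `r` thin strands. -/
def thin (r : ℕ) : Presented R := ⟨thinWord r⟩

/-- The `r`-fold split of a strand of thickness `r` into thin strands. -/
def splitAll : ∀ r : ℕ, strand R r ⟶ thin R r
  | 0 => 𝟙 _
  | r + 1 => split R 1 r (r + 1) ≫ strand R 1 ◁ splitAll r

/-- The `r`-fold merge of thin strands into a strand of thickness `r`. -/
def mergeAll : ∀ r : ℕ, thin R r ⟶ strand R r
  | 0 => 𝟙 _
  | r + 1 => strand R 1 ◁ mergeAll r ≫ merge R 1 r (r + 1)

/-- The morphism `f ⊗ ⋯ ⊗ f` on `r` thin strands. -/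
def thinPow (f : strand R 1 ⟶ strand R 1) : ∀ r : ℕ, thin R r ⟶ thin R r
  | 0 => 𝟙 _
  | r + 1 => f ⊗ₘ thinPow f r

/-- The balloon: split the strand of thickness `r` into `r` thin strands, apply `f` to each of them,
and merge. -/
def balloon (f : strand R 1 ⟶ strand R 1) (r : ℕ) : strand R r ⟶ strand R r :=
  splitAll R r ≫ thinPow R f r ≫ mergeAll R r

/-- The morphism `ω_r` on a strand of thickness `a`, for `0 ≤ r ≤ a`: split off a strand of
thickness `r` on the left, put the dot `ω_r` on it, and merge. It is zero if `r > a`. -/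
def omega (a r : ℕ) : strand R a ⟶ strand R a :=
  if h : r ≤ a then
    split R r (a - r) a ≫ dot R r ▷ strand R (a - r) ≫ merge R r (a - r) a
  else 0

/-- The morphism `g_{r,u}`, the sum over `0 ≤ i ≤ r` of `(-1)^i u (u + 1) ⋯ (u + i - 1) ω_{r-i}`
on a strand of thickness `r`. -/
def g (r : ℕ) (u : k) : strand R r ⟶ strand R r :=
  ∑ i ∈ range (r + 1), ((-1) ^ i * ∏ j ∈ range i, (u + (j : k))) • omega R r (r - i)

/-- The product `g_{r,u₁} ⋯ g_{r,u_ℓ}` in the endomorphism algebra of the strand of thickness `r`. -/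
def gProd {ℓ : ℕ} (u : Fin ℓ → k) (r : ℕ) : strand R r ⟶ strand R r :=
  (List.ofFn fun j => End.of (g R r (u j))).prod

end Diagrams

section Category

variable (k : Type v) [CommRing k]

/-- No relations: `Presented (noRel k)` is the free strict `k`-linear monoidal category on the
generating morphisms. -/
def noRel : ∀ X Y : List ℕ+, Term k Gen X Y → Term k Gen X Y → Prop := fun _ _ _ _ => False

/-- The defining relations of the affine web category, as pairs of parallel morphisms of the free
strict `k`-linear monoidal category. Diagrams are read from bottom to top and `f ≫ g` is `f` at the
bottom followed by `g`. -/
inductive WebRel : HomRel (Presented (noRel k))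
  -- associativity of merges and of splits
  | merge_assoc (a b c : ℕ) (ha : 0 < a) (hb : 0 < b) (hc : 0 < c) : WebRel
      (merge (noRel k) a b (a + b) ▷ strand _ c ≫ merge _ (a + b) c (a + b + c))
      ((α_ _ _ _).hom ≫ strand _ a ◁ merge _ b c (b + c) ≫ merge _ a (b + c) (a + b + c))
  | split_assoc (a b c : ℕ) (ha : 0 < a) (hb : 0 < b) (hc : 0 < c) : WebRel
      (split (noRel k) (a + b) c (a + b + c) ≫ split _ a b (a + b) ▷ strand _ c)
      (split _ a (b + c) (a + b + c) ≫ strand _ a ◁ split _ b c (b + c) ≫ (α_ _ _ _).inv)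
  -- a merge followed by a split
  | merge_split (a b c d : ℕ) (ha : 0 < a) (hb : 0 < b) (hc : 0 < c) (hd : 0 < d)
      (h : a + c = b + d) : WebRel
      (merge (noRel k) a c (a + c) ≫ split _ b d (a + c))
      (∑ s : Fin (min a b + 1), ∑ t : Fin (min c d + 1),
        if hst : (t : ℕ) + a = d + s then
          ladder (noRel k) s (a - s) (c - t) t (cross _ (a - s) (c - t))
        else 0)
  -- a split followed by a merge
  | split_merge (a b : ℕ) (ha : 0 < a) (hb : 0 < b) : WebRel
      (split (noRel k) a b (a + b) ≫ merge _ a b (a + b))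
      (((a + b).choose a : k) • 𝟙 (strand (noRel k) (a + b)))
  -- moving a dot through a crossing
  | cross_dot_left (a b : ℕ) (ha : 0 < a) (hb : 0 < b) : WebRel
      (cross (noRel k) a b ≫ dot _ b ▷ strand _ a)
      (∑ t : Fin (min a b + 1), (Nat.factorial t : k) •
        ladder (noRel k) t (a - t) (b - t) t
          (strand _ (a - t) ◁ dot _ (b - t) ≫ cross _ (a - t) (b - t)))
  | dot_left_cross (a b : ℕ) (ha : 0 < a) (hb : 0 < b) : WebRel
      (dot (noRel k) b ▷ strand _ a ≫ cross _ b a)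
      (∑ t : Fin (min a b + 1), (Nat.factorial t : k) •
        ladder (noRel k) t (b - t) (a - t) t
          (cross _ (b - t) (a - t) ≫ strand _ (a - t) ◁ dot _ (b - t)))
  -- moving a dot through a split or a merge
  | dot_split (a b : ℕ) (ha : 0 < a) (hb : 0 < b) : WebRel
      (dot (noRel k) (a + b) ≫ split _ a b (a + b)) (split _ a b (a + b) ≫ (dot _ a ⊗ₘ dot _ b))
  | merge_dot (a b : ℕ) (ha : 0 < a) (hb : 0 < b) : WebRel
      (merge (noRel k) a b (a + b) ≫ dot _ (a + b)) ((dot _ a ⊗ₘ dot _ b) ≫ merge _ a b (a + b))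
  -- the dotted balloon
  | balloon_dot (a : ℕ) (ha : 0 < a) : WebRel
      (balloon (noRel k) (dot _ 1) a) ((Nat.factorial a : k) • dot (noRel k) a)

/-- The defining relations of the affine web category, as pairs of terms. -/
def awRel : ∀ X Y : List ℕ+, Term k Gen X Y → Term k Gen X Y → Prop :=
  fun _ _ f g => WebRel k (Presented.homMk _ f) (Presented.homMk _ g)

/-- The affine web category over `k`. -/
abbrev AW := Presented (awRel k)

variable {k} {ℓ : ℕ} (u : Fin ℓ → k)

/-- The right tensor ideal generated by `g_{r,u₁} ⋯ g_{r,u_ℓ}` for all `r ≥ 1`. -/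
def cycIdeal : RightTensorIdeal k (AW k) :=
  .span k (.ofHoms fun r : {r : ℕ // 1 ≤ r} => gProd (awRel k) u r)

/-- The right tensor ideal generated by `g_{1,u₁} ⋯ g_{1,u_ℓ}`. -/
def thinIdeal : RightTensorIdeal k (AW k) :=
  .span k (.ofHoms fun _ : Unit => gProd (awRel k) u 1)

/-- The cyclotomic web category `Web_u`. -/
abbrev Web := (cycIdeal u).Quotient

/-- The category `Web'_u`. -/
abbrev Web' := (thinIdeal u).Quotient

end Category

variable {k : Type v} [CommRing k] (R : ∀ X Y : List ℕ+, Term k Gen X Y → Term k Gen X Y → Prop)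

theorem tensor_strand_zero (X : Presented R) : X ⊗ strand R 0 = X :=
  congrArg Presented.mk (List.append_nil X.word)

theorem whiskerRight_strand_zero {X Y : Presented R} (f : X ⟶ Y) :
    f ▷ strand R 0 = eqToHom (tensor_strand_zero R X) ≫ f ≫
      eqToHom (tensor_strand_zero R Y).symm := by
  rw [← Category.assoc, ← comp_eqToHom_iff (tensor_strand_zero R Y)]
  exact rightUnitor_naturality f

/-- The strand of thickness `a` with `ω_0` is the undotted strand. -/
theorem omega_zero (a : ℕ) : omega R a 0 = 𝟙 _ := by
  rw [omega, dif_pos (Nat.zero_le a)]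
  change split R 0 a a _ ≫ 𝟙 (strand R 0) ▷ strand R a ≫ merge R 0 a a _ = _
  rw [id_whiskerRight, Category.id_comp]
  simp [split, merge, splitAux, mergeAux]

/-- The morphism `ω_a` on the strand of thickness `a` is the generator. -/
theorem omega_self (a : ℕ) : omega R a a = dot R a := by
  have key : ∀ (b c : ℕ) (h : a + b = c) (hb : b = 0),
      split R a b c h ≫ dot R a ▷ strand R b ≫ merge R a b c h =
        eqToHom (by subst hb h; rfl) ≫ dot R a ≫ eqToHom (by subst hb h; rfl) := by
    intro b c h hb
    subst hb h
    rw [whiskerRight_strand_zero]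
    have aux : ∀ {A B : Presented R} (h₁ : A = B) (h₂ : B = A) (f : A ⟶ A),
        eqToHom h₁ ≫ eqToHom h₂ ≫ f ≫ eqToHom h₂.symm ≫ eqToHom h₁.symm = f := by
      intros
      simp
    cases a with
    | zero => simp [merge, mergeAux, split, splitAux]
    | succ n =>
      simp [merge, mergeAux, split, splitAux]
      exact aux _ _ _
  rw [omega, dif_pos le_rfl, key _ _ _ (Nat.sub_self a)]
  simp

/-- On a thin strand, `g_{1,u}` is the dot minus `u` times the identity. -/
theorem g_one (u : k) : g R 1 u = dot R 1 - u • 𝟙 (strand R 1) := by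
  simp [g, Finset.sum_range_succ, omega_zero, omega_self, sub_eq_add_neg]

end AffineWeb

namespace StrictPresentation

variable {S : Type} {k : Type v} [CommRing k] {G : List S → List S → Type}

/-! Write `f * g` for "split, apply `f ⊗ g`, merge" (`join`). By associativity of splits and merges
this is an associative bilinear product on endomorphisms of single strands, and `B_r(f)` is the
`r`-fold power of `f` (`balloon_succ`). The theorem rests on two facts.

The first is `B_r(g_{1,u}) = r! g_{r,u}` (`balloon_g`), by induction from `g_{1,u} * g_{r,u} = (r +
1) g_{r+1,u}` (`join_g`). The product `ω_1 * ω_j^{(r)}` is a multiple of `ω_{j+1}^{(r+1)}`. The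
product `1 * ω_{j+1}` is handled by capping the dot-crossing relation with a split and a merge,
which absorb the crossing: `1 * ω_{j+1} = ω_{j+1} * 1 - 1 * ω_j * 1` (`join_one_dot`). The resulting
recursion telescopes against the rising factorials in `g` (`sum_rising_smul`).

The second is `B_r(f) B_r(h) = r! B_r(fh)` whenever `f ⊗ f` commutes with the thin crossing
(`balloon_comp`). The full merge followed by the full split is built from thin crossings, so it
commutes with `f^{⊗r}`; the full split followed by the full merge is `r!`. Each `g_{1,u}` qualifies,
because `g_{1,u} ⊗ g_{1,u}` is symmetric in the two dots.

Together they give the balloon identity by induction on the number of factors, cancelling `r!`.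
Since `r!` is invertible, the generators of `I_u` are multiples of balloons of the single generator
of `I'_u`. Such a balloon lies in `I'_u`, as its leftmost strand already carries that generator; the
other inclusion is the case `r = 1`. -/

theorem Term.Rel.mono {R R' : ∀ X Y : List S, Term k G X Y → Term k G X Y → Prop}
    (hR : ∀ X Y f g, R X Y f g → R' X Y f g) {X Y : List S} {f g : Term k G X Y}
    (h : Term.Rel R f g) : Term.Rel R' f g := by
  induction h with
  | of h => exact .of (hR _ _ _ _ h)
  | symm _ ih => exact ih.symm
  | trans _ _ ih₁ ih₂ => exact ih₁.trans ih₂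
  | refl => exact .refl _
  | comp_congr _ _ ih₁ ih₂ => exact .comp_congr ih₁ ih₂
  | tensor_congr _ _ ih₁ ih₂ => exact .tensor_congr ih₁ ih₂
  | add_congr _ _ ih₁ ih₂ => exact .add_congr ih₁ ih₂
  | smul_congr _ _ ih => exact .smul_congr _ ih
  | id_comp => exact .id_comp _
  | comp_id => exact .comp_id _
  | comp_assoc => exact .comp_assoc _ _ _
  | add_assoc => exact .add_assoc _ _ _
  | add_comm => exact .add_comm _ _
  | zero_add => exact .zero_add _
  | one_smul => exact .one_smul _
  | zero_smul => exact .zero_smul _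
  | mul_smul => exact .mul_smul _ _ _
  | smul_add => exact .smul_add _ _ _
  | add_smul => exact .add_smul _ _ _
  | add_comp => exact .add_comp _ _ _
  | comp_add => exact .comp_add _ _ _
  | smul_comp => exact .smul_comp _ _ _
  | comp_smul => exact .comp_smul _ _ _
  | add_tensor => exact .add_tensor _ _ _
  | tensor_add => exact .tensor_add _ _ _
  | smul_tensor => exact .smul_tensor _ _ _
  | tensor_smul => exact .tensor_smul _ _ _
  | id_tensor_id => exact .id_tensor_id _ _
  | tensor_comp => exact .tensor_comp _ _ _ _
  | tensor_assoc => exact .tensor_assoc _ _ _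
  | unit_tensor => exact .unit_tensor _
  | tensor_unit => exact .tensor_unit _

end StrictPresentation

namespace AffineWeb

open StrictPresentation Finset

/-! ### Transport of relations from the free category -/

section Free

variable (k : Type v) [CommRing k]

/-- The quotient functor from the free category on the generating diagrams to the affine web
category. -/
def ofFree : Presented (noRel k) ⥤ AW k where
  obj X := ⟨X.word⟩
  map f := Quot.map id (fun _ _ h => h.mono (fun _ _ _ _ => False.elim)) f
  map_id _ := rfl
  map_comp := by rintro _ _ _ ⟨f⟩ ⟨g⟩; rfl

variable {k}

/-- The defining relations live in the free category, so each is used by pushing it through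
`ofFree`. The lemmas below let `simp` carry the functor through a diagram down to its generators. -/
theorem ofFree_eq_of_webRel {X Y : Presented (noRel k)} {f g : X ⟶ Y} (h : WebRel k f g) :
    (ofFree k).map f = (ofFree k).map g := by
  obtain ⟨f, rfl⟩ := Quot.exists_rep f
  obtain ⟨g, rfl⟩ := Quot.exists_rep g
  exact Quot.sound (.of h)

theorem ofFree_tensorHom {X Y X' Y' : Presented (noRel k)} (f : X ⟶ Y) (g : X' ⟶ Y') :
    (ofFree k).map (f ⊗ₘ g) = ((ofFree k).map f ⊗ₘ (ofFree k).map g :) := by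
  obtain ⟨f, rfl⟩ := Quot.exists_rep f
  obtain ⟨g, rfl⟩ := Quot.exists_rep g
  rfl

theorem ofFree_whiskerLeft (X : Presented (noRel k)) {Y Z : Presented (noRel k)} (f : Y ⟶ Z) :
    (ofFree k).map (X ◁ f) = ((ofFree k).obj X ◁ (ofFree k).map f :) := by
  obtain ⟨f, rfl⟩ := Quot.exists_rep f
  rfl

theorem ofFree_whiskerRight {X Y : Presented (noRel k)} (f : X ⟶ Y) (Z : Presented (noRel k)) :
    (ofFree k).map (f ▷ Z) = ((ofFree k).map f ▷ (ofFree k).obj Z :) := by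
  obtain ⟨f, rfl⟩ := Quot.exists_rep f
  rfl

theorem ofFree_add {X Y : Presented (noRel k)} (f g : X ⟶ Y) :
    (ofFree k).map (f + g) = (ofFree k).map f + (ofFree k).map g := by
  obtain ⟨f, rfl⟩ := Quot.exists_rep f
  obtain ⟨g, rfl⟩ := Quot.exists_rep g
  rfl

theorem ofFree_smul {X Y : Presented (noRel k)} (c : k) (f : X ⟶ Y) :
    (ofFree k).map (c • f) = c • (ofFree k).map f := by
  obtain ⟨f, rfl⟩ := Quot.exists_rep f
  rfl

/-- Associators are `eqToHom`s, which every functor preserves. -/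
theorem ofFree_associator_hom (X Y Z : Presented (noRel k)) :
    (ofFree k).map (α_ X Y Z).hom =
      (α_ ((ofFree k).obj X) ((ofFree k).obj Y) ((ofFree k).obj Z)).hom :=
  eqToHom_map (ofFree k) (congrArg Presented.mk (List.append_assoc _ _ _))

theorem ofFree_associator_inv (X Y Z : Presented (noRel k)) :
    (ofFree k).map (α_ X Y Z).inv =
      (α_ ((ofFree k).obj X) ((ofFree k).obj Y) ((ofFree k).obj Z)).inv :=
  eqToHom_map (ofFree k) (congrArg Presented.mk (List.append_assoc _ _ _).symm)

theorem ofFree_merge (a b c : ℕ) (h : a + b = c) :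
    (ofFree k).map (merge (noRel k) a b c h) = merge (awRel k) a b c h := by
  subst h
  rw [merge, merge, Functor.map_comp, eqToHom_map]
  congr 1
  rcases a with _ | a
  · exact eqToHom_map _ (by rw [Nat.zero_add]; rfl)
  rcases b with _ | b
  · exact eqToHom_map _ rfl
  · rfl

theorem ofFree_split (a b c : ℕ) (h : a + b = c) :
    (ofFree k).map (split (noRel k) a b c h) = split (awRel k) a b c h := by
  subst h
  rw [split, split, Functor.map_comp, eqToHom_map]
  congr 1
  rcases a with _ | a
  · exact eqToHom_map _ (by rw [Nat.zero_add]; rfl)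
  rcases b with _ | b
  · exact eqToHom_map _ rfl
  · rfl

theorem ofFree_cross (a b : ℕ) :
    (ofFree k).map (cross (noRel k) a b) = cross (awRel k) a b := by
  rcases a with _ | a <;> rcases b with _ | b
  · exact eqToHom_map _ rfl
  · exact eqToHom_map _ rfl
  · exact eqToHom_map _ rfl
  · rfl

theorem ofFree_dot (a : ℕ) : (ofFree k).map (dot (noRel k) a) = dot (awRel k) a := by
  cases a <;> rfl

end Free

/-! ### Strands of thickness zero as unitors -/

section ZeroThickness

variable {k : Type v} [CommRing k] (R : ∀ X Y : List ℕ+, Term k Gen X Y → Term k Gen X Y → Prop)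

theorem merge_zero_left (b : ℕ) (h : 0 + b = b) :
    merge R 0 b b h = (λ_ (strand R b)).hom := by
  simp only [merge, mergeAux, eqToHom_trans]
  rfl

theorem merge_zero_right (a : ℕ) (h : a + 0 = a) :
    merge R a 0 a h = (ρ_ (strand R a)).hom := by
  cases a <;> exact (eqToHom_trans rfl _).trans rfl

theorem split_zero_left (b : ℕ) (h : 0 + b = b) :
    split R 0 b b h = (λ_ (strand R b)).inv := by
  simp only [split, splitAux, eqToHom_trans]
  rfl

theorem split_zero_right (a : ℕ) (h : a + 0 = a) :
    split R a 0 a h = (ρ_ (strand R a)).inv := by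
  cases a <;> exact (eqToHom_trans _ rfl).trans rfl

theorem cross_zero_right (a : ℕ) :
    cross R a 0 = (ρ_ (strand R a)).hom ≫ (λ_ (strand R a)).inv := by
  have h : (ρ_ (strand R a)).hom ≫ (λ_ (strand R a)).inv =
      eqToHom (congrArg Presented.mk (List.append_nil _)) ≫ eqToHom rfl := rfl
  rw [h, eqToHom_trans]
  cases a <;> rfl

end ZeroThickness

/-! ### Degenerate ladders -/

section Ladders

variable {k : Type v} [CommRing k] (R : ∀ X Y : List ℕ+, Term k Gen X Y → Term k Gen X Y → Prop)

theorem ladder_eq {a b c d : ℕ} (s p q t : ℕ)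
    (x : strand R p ⊗ strand R q ⟶ strand R q ⊗ strand R p)
    (ha : s + p = a) (hc : q + t = c) (hb : s + q = b) (hd : p + t = d) :
    ladder R s p q t x ha hc hb hd =
      (split R s p a ha ⊗ₘ split R q t c hc) ≫ (α_ _ _ _).hom ≫
        strand R s ◁ ((α_ _ _ _).inv ≫ x ▷ strand R t ≫ (α_ _ _ _).hom) ≫
          (α_ _ _ _).inv ≫ (merge R s q b hb ⊗ₘ merge R p t d hd) := by
  rw [ladder]
  monoidal

/-- The shape of a ladder whose left outer strand is the unit, stated in an arbitrary monoidal
category so that `simp` sees unitors and not strands of thickness `0`. -/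
theorem unit_ladder {C : Type u} [Category.{v} C] [MonoidalCategory C] {P Q T X Y : C}
    (f : X ⟶ Q ⊗ T) (x : P ⊗ Q ⟶ Q ⊗ P) (g : P ⊗ T ⟶ Y) :
    ((λ_ P).inv ⊗ₘ f) ≫ (α_ _ _ _).hom ≫
        𝟙_ C ◁ ((α_ _ _ _).inv ≫ x ▷ T ≫ (α_ _ _ _).hom) ≫
          (α_ _ _ _).inv ≫ ((λ_ Q).hom ⊗ₘ g) =
      P ◁ f ≫ (α_ _ _ _).inv ≫ x ▷ T ≫ (α_ _ _ _).hom ≫ Q ◁ g := by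
  simp [MonoidalCategory.tensorHom_def]

theorem ladder_unit {C : Type u} [Category.{v} C] [MonoidalCategory C] {S P T X Y : C}
    (f : X ⟶ S ⊗ P) (y : P ⟶ P) (g : P ⊗ T ⟶ Y) :
    (f ⊗ₘ (λ_ T).inv) ≫ (α_ _ _ _).hom ≫
        S ◁ ((α_ _ _ _).inv ≫ ((ρ_ P).hom ≫ y ≫ (λ_ P).inv) ▷ T ≫ (α_ _ _ _).hom) ≫
          (α_ _ _ _).inv ≫ ((ρ_ S).hom ⊗ₘ g) =
      f ▷ T ≫ (α_ _ _ _).hom ≫ S ◁ (y ▷ T ≫ g) := by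
  simp [MonoidalCategory.tensorHom_def]

theorem ladder_zero_left {c d : ℕ} (p q t : ℕ)
    (x : strand R p ⊗ strand R q ⟶ strand R q ⊗ strand R p)
    (hp : 0 + p = p) (hc : q + t = c) (hq : 0 + q = q) (hd : p + t = d) :
    ladder R 0 p q t x hp hc hq hd =
      strand R p ◁ split R q t c hc ≫ (α_ _ _ _).inv ≫ x ▷ strand R t ≫ (α_ _ _ _).hom ≫
        strand R q ◁ merge R p t d hd := by
  rw [ladder_eq, split_zero_left, merge_zero_left]
  exact unit_ladder _ _ _

theorem ladder_zero_zero (p q : ℕ)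
    (x : strand R p ⊗ strand R q ⟶ strand R q ⊗ strand R p)
    (hp : 0 + p = p) (hq' : q + 0 = q) (hq : 0 + q = q) (hp' : p + 0 = p) :
    ladder R 0 p q 0 x hp hq' hq hp' = x := by
  rw [ladder_zero_left, split_zero_right, merge_zero_right]
  -- `strand R 0` is definitionally `𝟙_`. Writing the goal with `𝟙_` makes it a coherence identity;
  -- the same device recurs below.
  have h : strand R p ◁ (ρ_ (strand R q)).inv ≫ (α_ _ _ _).inv ≫ x ▷ 𝟙_ _ ≫ (α_ _ _ _).hom ≫
        strand R q ◁ (ρ_ (strand R p)).hom = x := by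
    simp
  exact h

theorem ladder_middle_zero {a d : ℕ} (s p t : ℕ) (y : strand R p ⟶ strand R p)
    (ha : s + p = a) (ht : 0 + t = t) (hs : s + 0 = s) (hd : p + t = d) :
    ladder R s p 0 t ((ρ_ (strand R p)).hom ≫ y ≫ (λ_ (strand R p)).inv) ha ht hs hd =
      split R s p a ha ▷ strand R t ≫ (α_ _ _ _).hom ≫
        strand R s ◁ (y ▷ strand R t ≫ merge R p t d hd) := by
  rw [ladder_eq, split_zero_left, merge_zero_right]
  exact ladder_unit _ _ _

/-- Needed because thicknesses such as `c - t` in the sum of ladders are only propositionally equal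
to their values. -/
theorem ladder_cross_congr {a b c d : ℕ} {s s' p p' q q' t t' : ℕ} (hs : s = s') (hp : p = p')
    (hq : q = q') (ht : t = t') (ha : s + p = a) (hc : q + t = c) (hb : s + q = b)
    (hd : p + t = d) :
    ladder R s p q t (cross R p q) ha hc hb hd =
      ladder R s' p' q' t' (cross R p' q') (by omega) (by omega) (by omega) (by omega) := by
  subst hs hp hq ht
  rfl

theorem ladder_cross_middle_zero {a d : ℕ} (s p t : ℕ)
    (ha : s + p = a) (ht : 0 + t = t) (hs : s + 0 = s) (hd : p + t = d) :
    ladder R s p 0 t (cross R p 0) ha ht hs hd =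
      split R s p a ha ▷ strand R t ≫ (α_ _ _ _).hom ≫ strand R s ◁ merge R p t d hd := by
  rw [← Category.id_comp (merge R p t d hd), ← id_whiskerRight,
    ← ladder_middle_zero R s p t _ ha ht hs hd,    cross_zero_right]
  congr 2
  exact (Category.id_comp _).symm

theorem ladder_zero_zero_cross (s t : ℕ)
    (hs : s + 0 = s) (ht : 0 + t = t) :
    ladder R s 0 0 t (cross R 0 0) hs ht hs ht = 𝟙 _ := by
  rw [ladder_cross_middle_zero, split_zero_right, merge_zero_left]
  have h : (ρ_ (strand R s)).inv ▷ strand R t ≫ (α_ _ _ _).hom ≫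
      strand R s ◁ (λ_ (strand R t)).hom = 𝟙 _ := by simp
  exact h

end Ladders

theorem sum_fin_eq_two {M : Type*} [AddCommMonoid M] {n : ℕ} (hn : n = 2) (F : Fin n → M) :
    ∑ i, F i = F ⟨0, by omega⟩ + F ⟨1, by omega⟩ := by
  subst hn
  exact Fin.sum_univ_two F

/-! ### Special cases of the relations with a thin strand -/

section FreeRelations

variable (k : Type v) [CommRing k]

theorem webRel_merge_split_thin (n : ℕ) : WebRel k
    (merge (noRel k) 1 (n + 1) (1 + (n + 1)) ≫ split _ 1 (n + 1) (1 + (n + 1)))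
    (strand _ 1 ◁ split _ 1 n (n + 1) ≫ (α_ _ _ _).inv ≫ cross _ 1 1 ▷ strand _ n ≫
      (α_ _ _ _).hom ≫ strand _ 1 ◁ merge _ 1 n (n + 1) + 𝟙 _) := by
  refine (congrArg (WebRel k _) ?_).mp (WebRel.merge_split (k := k) 1 1 (n + 1) (n + 1)
    one_pos one_pos n.succ_pos n.succ_pos rfl)
  refine (sum_fin_eq_two (by simp) _).trans (congrArg₂ _ ?_ ?_)
  -- The constraint `t - s = d - a` reads `t = n + s` here: `s = 0` leaves only `t = n`, the
  -- crossing term, and `s = 1` leaves only `t = n + 1`, the identity.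
  · refine (Fintype.sum_eq_single ⟨n, by simp⟩ fun t ht => dif_neg ?_).trans ?_
    · simp [Fin.ext_iff] at ht ⊢
      omega
    refine (dif_pos (by simp)).trans ?_
    refine (ladder_cross_congr _ (s' := 0) (p' := 1) (q' := 1) (t' := n) rfl rfl (by simp) rfl
      _ _ _ _).trans ?_
    exact ladder_zero_left _ _ _ _ _ _ _ _ _
  · refine (Fintype.sum_eq_single ⟨n + 1, by simp⟩ fun t ht => dif_neg ?_).trans ?_
    · simp [Fin.ext_iff] at ht ⊢
      omega
    refine (dif_pos (by simp)).trans ?_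
    refine (ladder_cross_congr _ (s' := 1) (p' := 0) (q' := 0) (t' := n + 1) rfl rfl (by simp) rfl
      _ _ _ _).trans ?_
    exact ladder_zero_zero_cross _ _ _ _ _

theorem webRel_merge_split_last (j : ℕ) : WebRel k
    (merge (noRel k) (j + 1) 1 (j + 1 + 1) ≫ split _ 1 (j + 1) (j + 1 + 1))
    (cross _ (j + 1) 1 +
      split _ 1 j (j + 1) ▷ strand _ 1 ≫ (α_ _ _ _).hom ≫ strand _ 1 ◁ merge _ j 1 (j + 1)) := by
  refine (congrArg (WebRel k _) ?_).mp (WebRel.merge_split (k := k) (j + 1) 1 1 (j + 1)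
    j.succ_pos one_pos one_pos j.succ_pos (by omega))
  refine (sum_fin_eq_two (by simp) _).trans (congrArg₂ _ ?_ ?_)
  -- Here the constraint forces `t = s`, so only the two diagonal terms survive.
  · refine (sum_fin_eq_two (by simp) _).trans ?_
    refine (congrArg₂ _ (dif_pos (by simp)) (dif_neg (by simp))).trans ((add_zero _).trans ?_)
    exact ladder_zero_zero _ _ _ _ _ _ _ _
  · refine (sum_fin_eq_two (by simp) _).trans ?_
    refine (congrArg₂ _ (dif_neg (by simp)) (dif_pos (by simp [add_comm]))).trans ((zero_add _).trans ?_)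
    exact ladder_cross_middle_zero _ _ _ _ _ _ _ _

theorem webRel_dot_cross_last (j : ℕ) : WebRel k
    (dot (noRel k) (j + 1) ▷ strand _ 1 ≫ cross _ (j + 1) 1)
    (cross _ (j + 1) 1 ≫ strand _ 1 ◁ dot _ (j + 1) +
      split _ 1 j (j + 1) ▷ strand _ 1 ≫ (α_ _ _ _).hom ≫
        strand _ 1 ◁ (dot _ j ▷ strand _ 1 ≫ merge _ j 1 (j + 1))) := by
  refine (congrArg (WebRel k _) ?_).mp (WebRel.dot_left_cross (k := k) 1 (j + 1) one_pos
    j.succ_pos)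
  refine (sum_fin_eq_two (by simp) _).trans (congrArg₂ _ ?_ ?_)
  -- Both coefficients `0!` and `1!` are `1`.
  · refine (congrArg (· • _) Nat.cast_one).trans ((one_smul _ _).trans ?_)
    exact ladder_zero_zero _ _ _ _ _ _ _ _
  · refine (congrArg (· • _) Nat.cast_one).trans ((one_smul _ _).trans ?_)
    refine Eq.trans ?_ (ladder_middle_zero _ _ _ _ _ (by omega) rfl rfl rfl)
    refine congrArg (fun x => ladder _ 1 j 0 1 x _ _ _ _) ?_
    refine (congrArg (· ≫ _) (cross_zero_right _ _)).trans ((Category.assoc _ _ _).trans ?_)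
    exact congrArg (_ ≫ ·) (leftUnitor_inv_naturality _).symm

theorem webRel_cross_dot_thin : WebRel k
    (cross (noRel k) 1 1 ≫ dot _ 1 ▷ strand _ 1)
    (strand _ 1 ◁ dot _ 1 ≫ cross _ 1 1 + 𝟙 _) := by
  refine (congrArg (WebRel k _) ?_).mp (WebRel.cross_dot_left (k := k) 1 1 one_pos one_pos)
  refine (sum_fin_eq_two (by simp) _).trans (congrArg₂ _ ?_ ?_)
  · refine (congrArg (· • _) Nat.cast_one).trans ((one_smul _ _).trans ?_)
    exact ladder_zero_zero _ _ _ _ _ _ _ _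
  · refine (congrArg (· • _) Nat.cast_one).trans ((one_smul _ _).trans ?_)
    refine Eq.trans ?_ (ladder_zero_zero_cross _ 1 1 rfl rfl)
    refine congrArg (fun x => ladder _ 1 0 0 1 x _ _ _ _) ?_
    exact (congrArg (· ≫ _) (whiskerLeft_id _ _)).trans (Category.id_comp _)

end FreeRelations

/-! ### Relations in the affine web category -/

section Relations

variable {k : Type v} [CommRing k]

/-- For positive thicknesses this is a defining relation; if one thickness is zero it is unit
coherence. The totals are separate variables, so that no transport between equal thicknesses appears
in later uses. -/
theorem merge_assoc (a b c ab bc abc : ℕ) (hab : a + b = ab) (hbc : b + c = bc)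
    (habc : ab + c = abc) (habc' : a + bc = abc) :
    merge (awRel k) a b ab hab ▷ strand _ c ≫ merge _ ab c abc habc =
      (α_ _ _ _).hom ≫ strand _ a ◁ merge _ b c bc hbc ≫ merge _ a bc abc habc' := by
  rcases a.eq_zero_or_pos with rfl | ha
  · obtain rfl : b = ab := by omega
    obtain rfl : bc = abc := by omega
    rw [merge_zero_left, merge_zero_left]
    have h : (λ_ (strand (awRel k) b)).hom ▷ strand _ c ≫ merge _ b c bc hbc =
      (α_ _ _ _).hom ≫ 𝟙_ _ ◁ merge _ b c bc hbc ≫ (λ_ _).hom := by simp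
    exact h
  rcases b.eq_zero_or_pos with rfl | hb
  · obtain rfl : a = ab := by omega
    obtain rfl : c = bc := by omega
    rw [merge_zero_left, merge_zero_right]
    have h : (ρ_ (strand (awRel k) a)).hom ▷ strand _ c ≫ merge _ a c abc habc =
      (α_ _ _ _).hom ≫ strand _ a ◁ (λ_ _).hom ≫ merge _ a c abc habc' := by simp
    exact h
  rcases c.eq_zero_or_pos with rfl | hc
  · obtain rfl : b = bc := by omega
    obtain rfl : ab = abc := by omega
    rw [merge_zero_right, merge_zero_right]
    have h : merge (awRel k) a b ab hab ▷ 𝟙_ _ ≫ (ρ_ _).hom =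
      (α_ _ _ _).hom ≫ strand _ a ◁ (ρ_ _).hom ≫ merge _ a b ab habc' := by simp
    exact h
  subst hab hbc habc
  have h := ofFree_eq_of_webRel (WebRel.merge_assoc (k := k) a b c ha hb hc)
  simp only [Functor.map_comp, ofFree_whiskerLeft, ofFree_whiskerRight, ofFree_merge,
    ofFree_associator_hom] at h
  exact h

theorem split_assoc (a b c ab bc abc : ℕ) (hab : a + b = ab) (hbc : b + c = bc)
    (habc : ab + c = abc) (habc' : a + bc = abc) :
    split (awRel k) ab c abc habc ≫ split _ a b ab hab ▷ strand _ c =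
      split _ a bc abc habc' ≫ strand _ a ◁ split _ b c bc hbc ≫ (α_ _ _ _).inv := by
  rcases a.eq_zero_or_pos with rfl | ha
  · obtain rfl : b = ab := by omega
    obtain rfl : bc = abc := by omega
    rw [split_zero_left, split_zero_left]
    have h : split (awRel k) b c bc hbc ≫ (λ_ _).inv ▷ strand _ c =
      (λ_ _).inv ≫ 𝟙_ _ ◁ split _ b c bc hbc ≫ (α_ _ _ _).inv := by simp
    exact h
  rcases b.eq_zero_or_pos with rfl | hb
  · obtain rfl : a = ab := by omega
    obtain rfl : c = bc := by omega
    rw [split_zero_left, split_zero_right]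
    have h : split (awRel k) a c abc habc ≫ (ρ_ _).inv ▷ strand _ c =
      split _ a c abc habc' ≫ strand _ a ◁ (λ_ _).inv ≫ (α_ _ _ _).inv := by simp
    exact h
  rcases c.eq_zero_or_pos with rfl | hc
  · obtain rfl : b = bc := by omega
    obtain rfl : ab = abc := by omega
    rw [split_zero_right, split_zero_right]
    have h : (ρ_ _).inv ≫ split (awRel k) a b ab hab ▷ 𝟙_ _ =
      split _ a b ab habc' ≫ strand _ a ◁ (ρ_ _).inv ≫ (α_ _ _ _).inv := by simp
    exact h
  subst hab hbc habc
  have h := ofFree_eq_of_webRel (WebRel.split_assoc (k := k) a b c ha hb hc)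
  simp only [Functor.map_comp, ofFree_whiskerLeft, ofFree_whiskerRight, ofFree_split,
    ofFree_associator_inv] at h
  exact h

theorem split_merge (a b c : ℕ) (h : a + b = c) :
    split (awRel k) a b c h ≫ merge _ a b c h = (c.choose a : k) • 𝟙 _ := by
  rcases a.eq_zero_or_pos with rfl | ha
  · obtain rfl : b = c := by omega
    rw [split_zero_left, merge_zero_left, Nat.choose_zero_right, Nat.cast_one, one_smul]
    exact Iso.inv_hom_id _
  rcases b.eq_zero_or_pos with rfl | hb
  · obtain rfl : a = c := by omega
    rw [split_zero_right, merge_zero_right, Nat.choose_self, Nat.cast_one, one_smul]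
    exact Iso.inv_hom_id _
  subst h
  have h := ofFree_eq_of_webRel (WebRel.split_merge (k := k) a b ha hb)
  simp only [Functor.map_comp, ofFree_smul, ofFree_split, ofFree_merge] at h
  exact h

theorem merge_dot (a b c : ℕ) (h : a + b = c) :
    merge (awRel k) a b c h ≫ dot _ c = (dot _ a ⊗ₘ dot _ b) ≫ merge _ a b c h := by
  rcases a.eq_zero_or_pos with rfl | ha
  · obtain rfl : b = c := by omega
    rw [merge_zero_left]
    have h : (λ_ _).hom ≫ dot (awRel k) b = (𝟙 (𝟙_ _) ⊗ₘ dot _ b) ≫ (λ_ _).hom := by simp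
    exact h
  rcases b.eq_zero_or_pos with rfl | hb
  · obtain rfl : a = c := by omega
    rw [merge_zero_right]
    have h : (ρ_ _).hom ≫ dot (awRel k) a = (dot _ a ⊗ₘ 𝟙 (𝟙_ _)) ≫ (ρ_ _).hom := by simp
    exact h
  subst h
  have h := ofFree_eq_of_webRel (WebRel.merge_dot (k := k) a b ha hb)
  simp only [Functor.map_comp, ofFree_tensorHom, ofFree_dot, ofFree_merge] at h
  exact h

theorem merge_split_thin (n N : ℕ) (h : 1 + (n + 1) = N) :
    merge (awRel k) 1 (n + 1) N h ≫ split _ 1 (n + 1) N h =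
      strand _ 1 ◁ split _ 1 n (n + 1) ≫ (α_ _ _ _).inv ≫ cross _ 1 1 ▷ strand _ n ≫
        (α_ _ _ _).hom ≫ strand _ 1 ◁ merge _ 1 n (n + 1) + 𝟙 _ := by
  subst h
  have h := ofFree_eq_of_webRel (webRel_merge_split_thin k n)
  simp only [Functor.map_comp, ofFree_whiskerLeft, ofFree_whiskerRight, ofFree_split,
    ofFree_merge, ofFree_cross, ofFree_associator_inv, ofFree_associator_hom, ofFree_add] at h
  exact h

theorem merge_split_last (j : ℕ) :
    merge (awRel k) (j + 1) 1 (j + 1 + 1) ≫ split _ 1 (j + 1) (j + 1 + 1) =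
      cross _ (j + 1) 1 +
        split _ 1 j (j + 1) ▷ strand _ 1 ≫ (α_ _ _ _).hom ≫
          strand _ 1 ◁ merge _ j 1 (j + 1) := by
  have h := ofFree_eq_of_webRel (webRel_merge_split_last k j)
  simp only [Functor.map_comp, ofFree_whiskerLeft, ofFree_whiskerRight, ofFree_split,
    ofFree_merge, ofFree_cross, ofFree_associator_hom, ofFree_add] at h
  exact h

theorem dot_cross_last (j : ℕ) :
    dot (awRel k) (j + 1) ▷ strand _ 1 ≫ cross _ (j + 1) 1 =
      cross _ (j + 1) 1 ≫ strand _ 1 ◁ dot _ (j + 1) +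
        split _ 1 j (j + 1) ▷ strand _ 1 ≫ (α_ _ _ _).hom ≫
          strand _ 1 ◁ (dot _ j ▷ strand _ 1 ≫ merge _ j 1 (j + 1)) := by
  have h := ofFree_eq_of_webRel (webRel_dot_cross_last k j)
  simp only [Functor.map_comp, ofFree_whiskerLeft, ofFree_whiskerRight, ofFree_split,
    ofFree_merge, ofFree_cross, ofFree_associator_hom, ofFree_add, ofFree_dot] at h
  exact h

theorem cross_dot_thin :
    cross (awRel k) 1 1 ≫ dot _ 1 ▷ strand _ 1 =
      strand _ 1 ◁ dot _ 1 ≫ cross _ 1 1 + 𝟙 _ := by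
  have h := ofFree_eq_of_webRel (webRel_cross_dot_thin k)
  simp only [Functor.map_comp, ofFree_whiskerLeft, ofFree_whiskerRight, ofFree_cross,
    ofFree_add, ofFree_dot] at h
  exact h

theorem dot_cross_thin :
    dot (awRel k) 1 ▷ strand _ 1 ≫ cross _ 1 1 =
      cross _ 1 1 ≫ strand _ 1 ◁ dot _ 1 + 𝟙 _ := by
  rw [dot_cross_last, split_zero_right, merge_zero_left]
  congr 1
  have h : (ρ_ (strand (awRel k) 1)).inv ▷ strand _ 1 ≫ (α_ _ _ _).hom ≫
      strand _ 1 ◁ (𝟙 (𝟙_ _) ▷ strand _ 1 ≫ (λ_ _).hom) = 𝟙 _ := by simp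
  exact h

/-- Solving `merge_split_last` for the crossing and merging leaves two split-merge bubbles, with
coefficient `(j + 2) - (j + 1) = 1`. The mirror argument gives `split_cross_last`. -/
theorem cross_merge_last (j : ℕ) :
    cross (awRel k) (j + 1) 1 ≫ merge _ 1 (j + 1) (j + 1 + 1) = merge _ (j + 1) 1 (j + 1 + 1) := by
  rw [← sub_eq_iff_eq_add.mpr (merge_split_last j), Preadditive.sub_comp]
  simp only [Category.assoc]
  rw [split_merge, ← merge_assoc 1 j 1 (j + 1) (j + 1) (j + 1 + 1) (by omega) rfl rfl (by omega),
    ← comp_whiskerRight_assoc, split_merge, MonoidalLinear.smul_whiskerRight, id_whiskerRight,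
    Linear.smul_comp, Linear.comp_smul, Category.comp_id, Category.id_comp, ← sub_smul]
  simp

theorem split_cross_last (j : ℕ) :
    split (awRel k) (j + 1) 1 (j + 1 + 1) ≫ cross _ (j + 1) 1 = split _ 1 (j + 1) (j + 1 + 1) := by
  have h := split_assoc (k := k) 1 j 1 (j + 1) (j + 1) (j + 1 + 1)
    (by omega) (by omega) (by omega) (by omega)
  rw [← sub_eq_iff_eq_add.mpr (merge_split_last j), Preadditive.comp_sub, reassoc_of% h,
    Iso.inv_hom_id_assoc, ← whiskerLeft_comp, split_merge, MonoidalLinear.whiskerLeft_smul,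
    whiskerLeft_id, Linear.comp_smul, Category.comp_id, reassoc_of% split_merge,
    Linear.smul_comp, Category.id_comp, ← sub_smul]
  simp

end Relations

/-! ### The product of strand endomorphisms and the recursion for `g` -/

section Join

variable {k : Type v} [CommRing k]

/-- The product of endomorphisms of strands of thickness `a` and `b`: split the strand of thickness
`c = a + b`, apply the two endomorphisms, and merge. -/
def join {a b c : ℕ} (h : a + b = c) :
    (strand (awRel k) a ⟶ strand (awRel k) a) →ₗ[k]
      (strand (awRel k) b ⟶ strand (awRel k) b) →ₗ[k]
        (strand (awRel k) c ⟶ strand (awRel k) c) :=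
  LinearMap.mk₂ k (fun f g => split _ a b c h ≫ (f ⊗ₘ g) ≫ merge _ a b c h)
    (fun f f' g => by simp [MonoidalPreadditive.add_tensor])
    (fun r f g => by simp [MonoidalCategory.tensorHom_def])
    (fun f g g' => by simp [MonoidalPreadditive.tensor_add])
    (fun r f g => by simp [MonoidalCategory.tensorHom_def])

theorem join_apply {a b c : ℕ} (h : a + b = c) (f : strand (awRel k) a ⟶ strand (awRel k) a)
    (g : strand (awRel k) b ⟶ strand (awRel k) b) :
    join h f g = split _ a b c h ≫ (f ⊗ₘ g) ≫ merge _ a b c h := rfl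

/-- Associativity of the product, isolated from thicknesses: it uses only coassociativity of the
splits, associativity of the merges and naturality of the associator. -/
theorem split_tensor_merge_assoc {C : Type u} [Category.{v} C] [MonoidalCategory C]
    {X Y Z XY YZ T : C} {s₁ : T ⟶ XY ⊗ Z} {s₂ : XY ⟶ X ⊗ Y} {s₃ : T ⟶ X ⊗ YZ} {s₄ : YZ ⟶ Y ⊗ Z}
    {m₁ : XY ⊗ Z ⟶ T} {m₂ : X ⊗ Y ⟶ XY} {m₃ : X ⊗ YZ ⟶ T} {m₄ : Y ⊗ Z ⟶ YZ}
    (hs : s₁ ≫ s₂ ▷ Z = s₃ ≫ X ◁ s₄ ≫ (α_ _ _ _).inv)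
    (hm : m₂ ▷ Z ≫ m₁ = (α_ _ _ _).hom ≫ X ◁ m₄ ≫ m₃) (f : X ⟶ X) (g : Y ⟶ Y) (e : Z ⟶ Z) :
    s₁ ≫ ((s₂ ≫ (f ⊗ₘ g) ≫ m₂) ⊗ₘ e) ≫ m₁ = s₃ ≫ (f ⊗ₘ (s₄ ≫ (g ⊗ₘ e) ≫ m₄)) ≫ m₃ := by
  have h₁ : ((s₂ ≫ (f ⊗ₘ g) ≫ m₂) ⊗ₘ e) = s₂ ▷ Z ≫ ((f ⊗ₘ g) ⊗ₘ e) ≫ m₂ ▷ Z := by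
    simp only [← tensorHom_id, tensorHom_comp_tensorHom, Category.id_comp, Category.comp_id]
  have h₂ : (f ⊗ₘ (s₄ ≫ (g ⊗ₘ e) ≫ m₄)) = X ◁ s₄ ≫ (f ⊗ₘ (g ⊗ₘ e)) ≫ X ◁ m₄ := by
    simp only [← id_tensorHom, tensorHom_comp_tensorHom, Category.id_comp, Category.comp_id]
  rw [h₁, h₂]
  simp only [Category.assoc]
  rw [hm, reassoc_of% hs, associator_naturality_assoc, Iso.inv_hom_id_assoc]

theorem join_assoc {a b c ab bc abc : ℕ} (hab : a + b = ab) (hbc : b + c = bc)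
    (habc : ab + c = abc) (habc' : a + bc = abc) (f : strand (awRel k) a ⟶ strand (awRel k) a)
    (g : strand (awRel k) b ⟶ strand (awRel k) b) (e : strand (awRel k) c ⟶ strand (awRel k) c) :
    join habc (join hab f g) e = join habc' f (join hbc g e) :=
  split_tensor_merge_assoc (split_assoc a b c ab bc abc hab hbc habc habc')
    (merge_assoc a b c ab bc abc hab hbc habc habc') f g e

theorem join_id_id {a b c : ℕ} (h : a + b = c) :
    join h (𝟙 (strand (awRel k) a)) (𝟙 _) = (c.choose a : k) • 𝟙 _ := by
  rw [join_apply, id_tensorHom_id, Category.id_comp, split_merge]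

theorem join_dot_dot {a b c : ℕ} (h : a + b = c) :
    join h (dot (awRel k) a) (dot _ b) = (c.choose a : k) • dot _ c := by
  rw [join_apply, ← merge_dot, reassoc_of% split_merge, Linear.smul_comp, Category.id_comp]

theorem omega_eq_join {a b c : ℕ} (h : a + b = c) :
    omega (awRel k) c a = join h (dot _ a) (𝟙 _) := by
  obtain rfl : b = c - a := by omega
  rw [omega, dif_pos (by omega), join_apply, tensorHom_id]

/-- Cap `dot_cross_last` with a split below and a merge above. Both absorb the crossing, and the
correction term becomes the triple product `1 * ω_j * 1`. -/
theorem join_one_dot (j : ℕ) :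
    join (by omega) (𝟙 (strand (awRel k) 1)) (dot _ (j + 1)) =
      join rfl (dot _ (j + 1)) (𝟙 (strand _ 1)) -
        join rfl (join (Nat.add_comm 1 j) (𝟙 (strand _ 1)) (dot _ j)) (𝟙 (strand _ 1)) := by
  have h₁ : join rfl (dot (awRel k) (j + 1)) (𝟙 (strand _ 1)) =
      split _ (j + 1) 1 _ ≫ (dot _ (j + 1) ▷ strand _ 1 ≫ cross _ (j + 1) 1) ≫
        merge _ 1 (j + 1) _ := by
    rw [Category.assoc, cross_merge_last, join_apply, tensorHom_id]
  rw [h₁, dot_cross_last, Preadditive.add_comp, Preadditive.comp_add, Category.assoc,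
    reassoc_of% split_cross_last, ← id_tensorHom, ← join_apply, add_sub_assoc, left_eq_add,
    sub_eq_zero, join_assoc (Nat.add_comm 1 j) rfl rfl (by omega)]
  rw [join_apply, join_apply, id_tensorHom, tensorHom_id]
  have h := split_assoc (k := k) 1 j 1 (j + 1) (j + 1) (j + 1 + 1)
    (by omega) (by omega) (by omega) (by omega)
  simp only [Category.assoc, reassoc_of% h, Iso.inv_hom_id_assoc, whiskerLeft_comp]

/-- Multiply `join_one_dot` on the right by the identity of thickness `b`; the factor `b + 1` comes
from fusing `1_1 * 1_b`. -/
theorem join_one_omega {j r b n : ℕ} (hr : j + b + 1 = r) (hn : 1 + r = n) :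
    join hn (𝟙 (strand (awRel k) 1)) (omega _ r (j + 1)) =
      ((b : k) + 1) • (omega _ n (j + 1) - join hn (𝟙 _) (omega _ r j)) := by
  have h : join (Nat.add_comm 1 b) (𝟙 (strand (awRel k) 1)) (𝟙 _) = ((b : k) + 1) • 𝟙 _ := by
    rw [join_id_id, Nat.choose_one_right, Nat.cast_add, Nat.cast_one]
  rw [omega_eq_join (show j + 1 + b = r by omega), omega_eq_join (show j + 1 + (b + 1) = n by omega),
    omega_eq_join (show j + (b + 1) = r by omega),
    ← join_assoc (by omega) _ (show j + 1 + 1 + b = n by omega), join_one_dot, map_sub,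
    LinearMap.sub_apply, join_assoc rfl (Nat.add_comm 1 b) _ (by omega),
    join_assoc rfl (Nat.add_comm 1 b) _ (by omega), h, map_smul, map_smul, ← smul_sub,
    join_assoc (Nat.add_comm 1 j) _ _ (by omega)]

theorem join_one_omega_zero {r n : ℕ} (hn : 1 + r = n) :
    join hn (𝟙 (strand (awRel k) 1)) (omega _ r 0) = (n : k) • omega _ n 0 := by
  rw [omega_zero, omega_zero, join_id_id, Nat.choose_one_right]

theorem join_dot_omega {j r n : ℕ} (hj : j ≤ r) (hn : 1 + r = n) :
    join hn (dot (awRel k) 1) (omega _ r j) = ((j : k) + 1) • omega _ n (j + 1) := by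
  rw [omega_eq_join (show j + (r - j) = r by omega),
    omega_eq_join (show j + 1 + (r - j) = n by omega),
    ← join_assoc (Nat.add_comm 1 j) _ (by omega), join_dot_dot, map_smul, LinearMap.smul_apply,
    Nat.choose_one_right, Nat.cast_add, Nat.cast_one]

/-- The telescoping behind `join_g`: `W` stands for the `ω`'s on the thicker strand, `Y` for their
predecessors multiplied by `1_1`, and `c` for the signed rising factorials. -/
theorem sum_rising_smul {M : Type*} [AddCommGroup M] [Module k M] (u : k) (c : ℕ → k)
    (W Y : ℕ → M) (r : ℕ) (hc : ∀ i, c (i + 1) = -(u + i) * c i)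
    (hY : ∀ i < r, Y i = ((i : k) + 1) • (W (i + 1) - Y (i + 1)))
    (hYr : Y r = ((r : k) + 1) • W (r + 1)) :
    ∑ i ∈ range (r + 1), c i • (((r : k) + 1 - i) • W i - u • Y i) =
      ((r : k) + 1) • ∑ i ∈ range (r + 2), c i • W i := by
  -- The partial sums agree up to one boundary term. The recursion for `Y` moves it along, and the
  -- value of `Y r` turns it into the missing last summand.
  have key : ∀ m ≤ r, ∑ i ∈ range (m + 1), c i • (((r : k) + 1 - i) • W i - u • Y i) =
      ((r : k) + 1) • (∑ i ∈ range (m + 1), c i • W i) + c (m + 1) • Y m := by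
    intro m
    induction m with
    | zero =>
      intro _
      simp only [zero_add, sum_range_one, hc 0]
      push_cast
      module
    | succ m ih =>
      intro hm
      rw [sum_range_succ, ih (by omega), sum_range_succ _ (m + 1), hY m (by omega), hc (m + 1)]
      push_cast
      module
  rw [key r le_rfl, sum_range_succ _ (r + 1), hYr]
  module

theorem join_g (u : k) {r n : ℕ} (hn : 1 + r = n) :
    join hn (g (awRel k) 1 u) (g _ r u) = ((r : k) + 1) • g _ n u := by
  obtain rfl : n = r + 1 := by omega
  -- The indices run downwards, since the `i`-th coefficient of `g` multiplies `ω_{r-i}`.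
  rw [g_one, g, g, ← sum_rising_smul u _ (fun i => omega (awRel k) (r + 1) (r + 1 - i))
    (fun i => join hn (𝟙 _) (omega _ r (r - i))) r, map_sum]
  · refine sum_congr rfl fun i hi => ?_
    have hi : i ≤ r := by simpa [Nat.lt_succ_iff] using hi
    rw [map_smul, map_sub, map_smul, LinearMap.sub_apply, LinearMap.smul_apply,
      join_dot_omega (Nat.sub_le _ _), Nat.cast_sub hi, Nat.sub_add_comm hi]
    congr 3
    ring
  · intro i
    rw [prod_range_succ]
    ring
  · intro i hi
    obtain ⟨j, rfl⟩ := Nat.exists_eq_add_of_lt hi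
    rw [show i + j + 1 - i = j + 1 by omega, show i + j + 1 + 1 - (i + 1) = j + 1 by omega,
      show i + j + 1 - (i + 1) = j by omega, join_one_omega (show j + i + 1 = i + j + 1 by omega)]
  · simp [join_one_omega_zero]

end Join

/-! ### Balloons and endomorphisms compatible with the crossing -/

section Balloons

variable {k : Type v} [CommRing k]

theorem comp_whiskerLeft_tensor {C : Type u} [Category.{v} C] [MonoidalCategory C]
    {X Y Z T : C} (s : Z ⟶ X ⊗ Y) (s' : Y ⟶ T) (f : X ⟶ X) (g : T ⟶ T) (m' : T ⟶ Y)
    (m : X ⊗ Y ⟶ Z) :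
    (s ≫ X ◁ s') ≫ (f ⊗ₘ g) ≫ X ◁ m' ≫ m = s ≫ (f ⊗ₘ (s' ≫ g ≫ m')) ≫ m := by
  have h : (f ⊗ₘ (s' ≫ g ≫ m')) = X ◁ s' ≫ (f ⊗ₘ g) ≫ X ◁ m' := by
    simp only [← id_tensorHom, tensorHom_comp_tensorHom, Category.id_comp, Category.comp_id]
  rw [h]
  simp only [Category.assoc]

theorem balloon_succ (f : strand (awRel k) 1 ⟶ strand _ 1) {r n : ℕ} (h : 1 + r = n) :
    balloon (awRel k) f n = join h f (balloon _ f r) := by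
  obtain rfl : n = r + 1 := by omega
  exact comp_whiskerLeft_tensor _ _ _ _ _ _

theorem balloon_g (u : k) (r : ℕ) :
    balloon (awRel k) (g _ 1 u) r = (r.factorial : k) • g _ r u := by
  induction r with
  | zero =>
    have h : g (awRel k) 0 u = 𝟙 _ := by simp [g, omega_zero]
    rw [h, balloon, splitAll, mergeAll, thinPow, Nat.factorial_zero, Nat.cast_one, one_smul]
    exact (Category.id_comp _).trans (Category.id_comp _)
  | succ r ih =>
    rw [balloon_succ _ (Nat.add_comm 1 r), ih, map_smul, join_g, smul_smul, Nat.factorial_succ]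
    push_cast
    rw [mul_comm]

theorem balloon_id (r : ℕ) :
    balloon (awRel k) (𝟙 _) r = (r.factorial : k) • 𝟙 _ := by
  induction r with
  | zero =>
    rw [balloon, splitAll, mergeAll, thinPow, Nat.factorial_zero, Nat.cast_one, one_smul]
    exact (Category.id_comp _).trans (Category.id_comp _)
  | succ r ih =>
    rw [balloon_succ _ (Nat.add_comm 1 r), ih, map_smul, join_id_id, smul_smul,
      Nat.choose_one_right, Nat.factorial_succ]
    push_cast
    rw [mul_comm]

theorem thinPow_id (r : ℕ) : thinPow (awRel k) (𝟙 _) r = 𝟙 _ := by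
  induction r with
  | zero => rfl
  | succ r ih =>
    rw [thinPow, ih]
    exact id_tensorHom_id _ _

theorem thinPow_comp (f g : strand (awRel k) 1 ⟶ strand _ 1) (r : ℕ) :
    thinPow (awRel k) (f ≫ g) r = thinPow _ f r ≫ thinPow _ g r := by
  induction r with
  | zero => exact (Category.id_comp _).symm
  | succ r ih =>
    rw [thinPow, ih]
    exact (tensorHom_comp_tensorHom _ _ _ _).symm

theorem splitAll_mergeAll (r : ℕ) :
    splitAll (awRel k) r ≫ mergeAll _ r = (r.factorial : k) • 𝟙 _ := by
  rw [← balloon_id, balloon, thinPow_id, Category.id_comp]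

/-- The endomorphisms `f` of a thin strand such that `f ⊗ f` commutes with the crossing. -/
def crossCommuting (k : Type v) [CommRing k] : Submonoid (End (strand (awRel k) 1)) where
  carrier := {f | (f ⊗ₘ f) ≫ cross _ 1 1 = cross _ 1 1 ≫ (f ⊗ₘ f)}
  one_mem' := by
    change (𝟙 _ ⊗ₘ 𝟙 _) ≫ _ = _ ≫ (𝟙 _ ⊗ₘ 𝟙 _)
    rw [id_tensorHom_id, Category.id_comp, Category.comp_id]
  mul_mem' {f g} hf hg := by
    change (g ≫ f ⊗ₘ g ≫ f) ≫ _ = _ ≫ (g ≫ f ⊗ₘ g ≫ f)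
    change (f ⊗ₘ f) ≫ _ = _ ≫ (f ⊗ₘ f) at hf
    change (g ⊗ₘ g) ≫ _ = _ ≫ (g ⊗ₘ g) at hg
    rw [← tensorHom_comp_tensorHom, Category.assoc, hf, reassoc_of% hg]

/-- `(ω - u) ⊗ (ω - u)` is a combination of the elementary symmetric functions in the two dots.
These commute with the crossing because the correction terms of the two dot-crossing relations
cancel. -/
theorem g_one_mem_crossCommuting (u : k) : End.of (g (awRel k) 1 u) ∈ crossCommuting k := by
  change (g (awRel k) 1 u ⊗ₘ g _ 1 u) ≫ cross _ 1 1 = cross _ 1 1 ≫ (g _ 1 u ⊗ₘ g _ 1 u)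
  have h : (g (awRel k) 1 u ⊗ₘ g _ 1 u) = dot _ 1 ▷ _ ≫ strand _ 1 ◁ dot _ 1 -
      u • (dot _ 1 ▷ strand _ 1 + strand _ 1 ◁ dot _ 1) + (u * u) • 𝟙 _ := by
    rw [g_one, MonoidalCategory.tensorHom_def, sub_eq_add_neg, ← neg_smul]
    simp only [MonoidalPreadditive.add_whiskerRight, MonoidalPreadditive.whiskerLeft_add,
      MonoidalLinear.smul_whiskerRight, MonoidalLinear.whiskerLeft_smul, id_whiskerRight,
      whiskerLeft_id, Preadditive.add_comp, Preadditive.comp_add, Linear.smul_comp,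
      Linear.comp_smul, Category.id_comp, Category.comp_id]
    module
  have h₁ : (dot (awRel k) 1 ▷ strand _ 1 ≫ strand _ 1 ◁ dot _ 1) ≫ cross _ 1 1 =
      cross _ 1 1 ≫ dot _ 1 ▷ strand _ 1 ≫ strand _ 1 ◁ dot _ 1 := by
    rw [reassoc_of% cross_dot_thin, ← whisker_exchange, Category.assoc, dot_cross_thin,
      Preadditive.add_comp, Preadditive.comp_add, Category.assoc, Category.comp_id,
      Category.id_comp]
  have h₂ : (dot (awRel k) 1 ▷ strand _ 1 + strand _ 1 ◁ dot _ 1) ≫ cross _ 1 1 =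
      cross _ 1 1 ≫ (dot _ 1 ▷ strand _ 1 + strand _ 1 ◁ dot _ 1) := by
    rw [Preadditive.add_comp, Preadditive.comp_add, dot_cross_thin, cross_dot_thin]
    abel
  rw [h, Preadditive.add_comp, Preadditive.comp_add, Preadditive.sub_comp, Preadditive.comp_sub,
    Linear.smul_comp, Linear.comp_smul, Linear.smul_comp, Linear.comp_smul, h₁, h₂,
    Category.id_comp, Category.comp_id]

/-- Whiskering on the right is enough, since the leftmost strand carries `f`; the other factors are
then applied by composition. At least one strand is required. -/
theorem thinPow_mem_carrier (I : RightTensorIdeal k (AW k)) {f : strand (awRel k) 1 ⟶ strand _ 1}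
    (hf : f ∈ I.carrier _ _) (r : ℕ) : thinPow _ f (r + 1) ∈ I.carrier _ _ := by
  have h : f ▷ thin _ r ≫ strand _ 1 ◁ thinPow _ f r ∈ I.carrier _ _ :=
    I.postcomp_mem _ (I.whiskerRight_mem _ hf)
  rw [← MonoidalCategory.tensorHom_def] at h
  exact h

end Balloons

/-! ### Multiplicativity of balloons and the balloon identity -/

section Field

variable {k : Type v} [Field k]

/-- Inductive step for `thinPow_mergeAll_splitAll`: `X` is a thin strand, `T` is `n` thin strands,
`N`, `N'`, `P` are strands of thickness `n`, `n + 1`, `n + 2`, and `c = n!`. The merge-split on `n +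
2` strands is expressed through the one on `n + 1` strands and a single thin crossing. -/
theorem tensor_comm_of_merge_split {C : Type u} [Category.{v} C] [Preadditive C]
    [Linear k C] [MonoidalCategory C] [MonoidalPreadditive C] [MonoidalLinear k C]
    {X N N' T P : C} {f : X ⟶ X} {F : T ⟶ T} {x : X ⊗ X ⟶ X ⊗ X}
    (hx : (f ⊗ₘ f) ≫ x = x ≫ (f ⊗ₘ f))
    {M' : T ⟶ N} {S' : N ⟶ T} {M : X ⊗ T ⟶ N'} {S : N' ⟶ X ⊗ T}
    {m : X ⊗ N ⟶ N'} {s : N' ⟶ X ⊗ N} {m₁ : X ⊗ N' ⟶ P} {s₁ : P ⟶ X ⊗ N'} {c : k} (hc : c ≠ 0)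
    (hM : X ◁ M' ≫ m = M) (hS : s ≫ X ◁ S' = S) (hSM : S' ≫ M' = c • 𝟙 _)
    (hF : (f ⊗ₘ F) ≫ M ≫ S = M ≫ S ≫ (f ⊗ₘ F))
    (hms : m₁ ≫ s₁ = X ◁ s ≫ (α_ _ _ _).inv ≫ x ▷ N ≫ (α_ _ _ _).hom ≫ X ◁ m + 𝟙 _) :
    (f ⊗ₘ f ⊗ₘ F) ≫ (X ◁ M ≫ m₁) ≫ (s₁ ≫ X ◁ S) =
      (X ◁ M ≫ m₁) ≫ (s₁ ≫ X ◁ S) ≫ (f ⊗ₘ f ⊗ₘ F) := by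
  -- `S'` and `M'` slide past the crossing on the other two strands and meet, giving `c`.
  have middle : X ◁ X ◁ S' ≫ (α_ X X T).inv ≫ x ▷ T ≫ (α_ X X T).hom ≫ X ◁ X ◁ M' =
      c • ((α_ X X N).inv ≫ x ▷ N ≫ (α_ X X N).hom) := by
    have h : X ◁ X ◁ S' ≫ (α_ X X T).inv ≫ x ▷ T ≫ (α_ X X T).hom ≫ X ◁ X ◁ M' =
        (α_ X X N).inv ≫ x ▷ N ≫ (X ⊗ X) ◁ (S' ≫ M') ≫ (α_ X X N).hom := by
      rw [whiskerLeft_comp, Category.assoc, ← whisker_exchange_assoc]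
      simp
    rw [h, hSM, MonoidalLinear.whiskerLeft_smul, whiskerLeft_id, Linear.smul_comp,
      Category.id_comp, Linear.comp_smul, Linear.comp_smul]
  -- With `E = X ◁ (M ≫ S)` and `Z` the crossing of the first two strands, this is `c⁻¹ E Z E + E`.
  -- The inverse compensates for the `S' ≫ M'` inserted to complete both copies of `E`; this is
  -- where `n!` must be invertible.
  have expand : (X ◁ M ≫ m₁) ≫ (s₁ ≫ X ◁ S) =
      c⁻¹ • (X ◁ (M ≫ S) ≫ ((α_ X X T).inv ≫ x ▷ T ≫ (α_ X X T).hom) ≫ X ◁ (M ≫ S)) +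
        X ◁ (M ≫ S) := by
    have h : X ◁ (M ≫ S) ≫ ((α_ X X T).inv ≫ x ▷ T ≫ (α_ X X T).hom) ≫ X ◁ (M ≫ S) =
        X ◁ (M ≫ s) ≫ (X ◁ X ◁ S' ≫ (α_ X X T).inv ≫ x ▷ T ≫ (α_ X X T).hom ≫ X ◁ X ◁ M') ≫
          X ◁ (m ≫ S) := by
      nth_rw 2 [← hM]
      nth_rw 1 [← hS]
      simp only [whiskerLeft_comp, Category.assoc]
    rw [h, middle, Linear.smul_comp, Linear.comp_smul, inv_smul_smul₀ hc, Category.assoc,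
      reassoc_of% hms]
    simp only [Preadditive.add_comp, Preadditive.comp_add, whiskerLeft_comp, Category.assoc,
      Category.id_comp]
  have hE : (f ⊗ₘ f ⊗ₘ F) ≫ X ◁ (M ≫ S) = X ◁ (M ≫ S) ≫ (f ⊗ₘ f ⊗ₘ F) := by
    simp only [← id_tensorHom, tensorHom_comp_tensorHom, Category.id_comp, Category.comp_id,
      Category.assoc, hF]
  have hX : (f ⊗ₘ f ⊗ₘ F) ≫ (α_ X X T).inv ≫ x ▷ T ≫ (α_ X X T).hom =
      ((α_ X X T).inv ≫ x ▷ T ≫ (α_ X X T).hom) ≫ (f ⊗ₘ f ⊗ₘ F) := by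
    have h : ((f ⊗ₘ f) ⊗ₘ F) ≫ x ▷ T = x ▷ T ≫ ((f ⊗ₘ f) ⊗ₘ F) := by
      simp only [← tensorHom_id, tensorHom_comp_tensorHom, Category.id_comp, Category.comp_id, hx]
    rw [associator_inv_naturality_assoc, reassoc_of% h]
    simp only [Category.assoc, associator_naturality]
  generalize (α_ X X T).inv ≫ x ▷ T ≫ (α_ X X T).hom = Z at expand hX
  rw [← Category.assoc (X ◁ M ≫ m₁) (s₁ ≫ X ◁ S), expand, Preadditive.comp_add,
    Preadditive.add_comp, hE, Linear.comp_smul, Linear.smul_comp, reassoc_of% hE,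
    reassoc_of% hX]
  simp only [Category.assoc, hE]

variable [CharZero k]

theorem thinPow_mergeAll_splitAll {f : strand (awRel k) 1 ⟶ strand _ 1}
    (hf : End.of f ∈ crossCommuting k) (r : ℕ) :
    thinPow _ f r ≫ mergeAll _ r ≫ splitAll _ r = mergeAll _ r ≫ splitAll _ r ≫ thinPow _ f r := by
  induction r with
  | zero => rfl
  | succ r ih =>
    rcases r with _ | n
    -- One strand is a separate base case, because the inductive step peels off two thin strands.
    · have h : mergeAll (awRel k) 1 ≫ splitAll _ 1 = 𝟙 _ := by
        rw [mergeAll, splitAll, mergeAll, splitAll, merge_zero_right, split_zero_right]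
        have h : ∀ X : AW k, (X ◁ 𝟙 (𝟙_ _) ≫ (ρ_ X).hom) ≫ (ρ_ X).inv ≫ X ◁ 𝟙 (𝟙_ _) = 𝟙 _ := by
          simp
        exact h _
      rw [reassoc_of% h, h, Category.comp_id]
    · exact tensor_comm_of_merge_split (k := k) hf (Nat.cast_ne_zero.mpr n.factorial_ne_zero) rfl rfl
        (splitAll_mergeAll n) ih (merge_split_thin n (n + 2) (by omega))

theorem balloon_comp {f : strand (awRel k) 1 ⟶ strand _ 1} (hf : End.of f ∈ crossCommuting k)
    (g : strand (awRel k) 1 ⟶ strand _ 1) (r : ℕ) :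
    balloon _ f r ≫ balloon _ g r = (r.factorial : k) • balloon _ (f ≫ g) r := by
  simp only [balloon, Category.assoc, thinPow_comp]
  rw [reassoc_of% thinPow_mergeAll_splitAll hf r, reassoc_of% splitAll_mergeAll (k := k) r,
    Linear.smul_comp, Category.id_comp]

theorem factorial_smul_gProd {ℓ : ℕ} (u : Fin ℓ → k) (r : ℕ) :
    (r.factorial : k) • gProd (awRel k) u r = balloon (awRel k) (gProd (awRel k) u 1) r := by
  simp only [gProd]
  -- The induction also carries crossing-compatibility of the partial products, which `balloon_comp`
  -- requires.
  suffices h : ∀ L : List k,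
      (L.map fun a => End.of (g (awRel k) 1 a)).prod ∈ crossCommuting k ∧
      (r.factorial : k) • (L.map fun a => End.of (g (awRel k) r a)).prod =
        End.of (balloon (awRel k) (L.map fun a => End.of (g (awRel k) 1 a)).prod.asHom r) by
    have h' := (h (List.ofFn u)).2
    simp only [List.map_ofFn] at h'
    exact h'
  intro L
  induction L with
  | nil => exact ⟨one_mem _, (balloon_id r).symm⟩
  | cons a L ih =>
    obtain ⟨hmem, ih⟩ := ih
    refine ⟨?_, ?_⟩
    · rw [List.map_cons, List.prod_cons]
      exact mul_mem (g_one_mem_crossCommuting a) hmem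
    · have hr : (r.factorial : k) ≠ 0 := Nat.cast_ne_zero.mpr r.factorial_ne_zero
      -- `balloon_comp` and `balloon_g` give the claim multiplied by a further `r!`, which is
      -- cancelled in characteristic zero. Multiplication in `End` is reversed composition, so the
      -- new factor comes last.
      refine smul_right_injective _ hr ?_
      have h := balloon_comp hmem (g _ 1 a) r
      rw [balloon_g, Linear.comp_smul] at h
      simp only [List.map_cons, List.prod_cons]
      refine Eq.trans ?_ h
      refine congrArg (_ • ·) ?_
      refine Eq.trans ?_ (congrArg (· ≫ g _ r a) ih)
      exact (Linear.smul_comp _ _ _ _ _ _).symm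

theorem gProd_mem_thinIdeal {ℓ : ℕ} (u : Fin ℓ → k) {r : ℕ} (hr : 1 ≤ r) :
    gProd (awRel k) u r ∈ (thinIdeal u).carrier _ _ := by
  have hr' : (r.factorial : k) ≠ 0 := Nat.cast_ne_zero.mpr r.factorial_ne_zero
  rw [← inv_smul_smul₀ hr' (gProd (awRel k) u r), factorial_smul_gProd]
  obtain ⟨r, rfl⟩ := Nat.exists_eq_add_of_le' hr
  exact Submodule.smul_mem _ _ ((thinIdeal u).precomp_mem _ ((thinIdeal u).postcomp_mem _
    (thinPow_mem_carrier _ (RightTensorIdeal.SpanMem.of (.mk ())) r)))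

end Field

end AffineWeb

/-! ### Comparison of the ideals and of their quotients -/

namespace RightTensorIdeal

variable {k : Type w} {C : Type u} [CommRing k] [Category.{v} C] [Preadditive C] [Linear k C]
  [MonoidalCategory C]

/-- Minimality of the generated ideal, which reduces each inclusion to its generators. -/
theorem SpanMem.mem {P : MorphismProperty C} {I : RightTensorIdeal k C}
    (hP : ∀ ⦃X Y : C⦄ (f : X ⟶ Y), P f → f ∈ I.carrier X Y) {X Y : C} {f : X ⟶ Y}
    (hf : SpanMem k P f) : f ∈ I.carrier X Y := by
  induction hf with
  | of h => exact hP _ h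
  | zero => exact zero_mem _
  | add _ _ h₁ h₂ => exact add_mem h₁ h₂
  | smul c _ h => exact Submodule.smul_mem _ c h
  | precomp f _ h => exact I.precomp_mem f h
  | postcomp g _ h => exact I.postcomp_mem g h
  | whiskerRight Z _ h => exact I.whiskerRight_mem Z h

/-- Equal right tensor ideals have isomorphic quotients. -/
theorem exists_quotient_iso {I J : RightTensorIdeal k C} (h : I = J) :
    ∃ (F : I.Quotient ⥤ J.Quotient) (F' : J.Quotient ⥤ I.Quotient),
      F ⋙ F' = 𝟭 _ ∧ F' ⋙ F = 𝟭 _ ∧ F.Additive ∧ F.Linear k ∧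
      I.quotientFunctor ⋙ F = J.quotientFunctor := by
  subst h
  exact ⟨𝟭 _, 𝟭 _, rfl, rfl, inferInstance, inferInstance, rfl⟩

end RightTensorIdeal

theorem AffineWeb.thinIdeal_eq_cycIdeal {k : Type v} [Field k] [CharZero k] {ℓ : ℕ}
    (u : Fin ℓ → k) : thinIdeal u = cycIdeal u := by
  ext X Y f
  constructor
  · refine fun hf => RightTensorIdeal.SpanMem.mem ?_ hf
    rintro _ _ _ ⟨⟨⟩⟩
    exact .of (.mk (⟨1, le_rfl⟩ : {r : ℕ // 1 ≤ r}))
  · refine fun hf => RightTensorIdeal.SpanMem.mem ?_ hf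
    rintro _ _ _ ⟨⟨r, hr⟩⟩
    exact gProd_mem_thinIdeal u hr

theorem theorem5p5 {k : Type*} [Field k] [CharZero k] {ℓ : ℕ} (hℓ : 1 ≤ ℓ) (u : Fin ℓ → k) :
    -- the two right tensor ideals coincide
    AffineWeb.thinIdeal u = AffineWeb.cycIdeal u ∧
    -- the quotient categories are isomorphic as `k`-linear categories, compatibly with the
    -- quotient functors
    (∃ (F : AffineWeb.Web' u ⥤ AffineWeb.Web u) (F' : AffineWeb.Web u ⥤ AffineWeb.Web' u),
      F ⋙ F' = 𝟭 _ ∧ F' ⋙ F = 𝟭 _ ∧ F.Additive ∧ F.Linear k ∧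
      (AffineWeb.thinIdeal u).quotientFunctor ⋙ F = (AffineWeb.cycIdeal u).quotientFunctor) ∧
    -- the balloon identity
    ∀ r : ℕ, 1 ≤ r →
      (Nat.factorial r : k) • AffineWeb.gProd (AffineWeb.awRel k) u r =
        AffineWeb.balloon (AffineWeb.awRel k) (AffineWeb.gProd (AffineWeb.awRel k) u 1) r := by
  exact ⟨AffineWeb.thinIdeal_eq_cycIdeal u,
    RightTensorIdeal.exists_quotient_iso (AffineWeb.thinIdeal_eq_cycIdeal u),
    fun r _ => AffineWeb.factorial_smul_gProd u r⟩
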